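/- **Oracle.** For a probability distribution $D$ on the Euclidean unit ball $\mathcal B_2^d\subset\mathbb R^d$ and $\tau>0$, a $\mathrm{STAT}_D(\tau)$ oracle receives (measurable) functions $\phi$ with values in $[-1,1]$ on $\mathcal B_2^d$ and answers each with some number $v$ satisfying $|v-\mathbb E_{\mathbf w\sim D}[\phi(\mathbf w)]|\le\tau$; answers may be adversarial and depend on all earlier queries and answers. **Machine model.** A randomized statistical query algorithm is a single finite program, with rational constants, for a real RAM: memory consists of index registers (natural numbers) and real arrays; real $+,-,\times,/,\sqrt{\ },\max,\min$ and comparisons are exact and have unit cost, there is no rounding operation, finite sums and loops are charged for all their terms and iterations. It can draw independent standard normal numbers at unit cost and can query the oracle with a function $w\mapsto\phi(w)$ described by an arithmetic expression in the memory and the coordinates of $w$; a query is charged for one evaluation of $\phi$. Its inputs are $d$, $\varepsilon$, $\delta$ and its output is a vector in $\mathbb R^d$. **Notation.** For $a>0$ let $m_a(z)=\max(-a,\min(a,z))$. A *high-dimensional median* of $w^1,\dots,w^k\in\mathbb R^d$ is a point $w^j$ whose median distance to the other points (the smallest $r$ such that at least half of the other points are within distance $r$ of $w^j$) is the smallest.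 **Theorem.** There are a randomized statistical query algorithm and absolute constants $c,C>0$ and $K\in\mathbb N$ such that the following holds for all $d\ge1$, $\varepsilon>0$ and $0<\delta<1$. For every probability distribution $D$ supported on $\mathcal B_2^d$ and every $\mathrm{STAT}_D(\tau)$ oracle with $$\tau=\frac{c\,\varepsilon}{\max\{1,\log(1/\varepsilon)\}},$$ on the input $(d,\varepsilon,\delta)$ the algorithm 1. always halts, after at most $C\,d\,\max\{1,\log(1/\delta)\}$ queries and at most $C\bigl(d\cdot\max\{1,\log(1/\varepsilon)\}\cdot\max\{1,\log(1/\delta)\}\bigr)^K$ steps; 2. outputs, except with probability at most $\delta$ over its own random numbers, a vector $\tilde w$ with $\|\mathbb E_{\mathbf w\sim D}[\mathbf w]-\tilde w\|_2\le\varepsilon$. Moreover, there are an integer $k$ and a real $a>0$, depending only on $(d,\varepsilon,\delta)$, and independent uniformly random orthonormal bases $\mathbf u^1,\dots,\mathbf u^k$ of $\mathbb R^d$ (functions of the algorithm's random numbers, not depending on $D$ or the oracle), such that almost surely the algorithm asks exactly the queries $w\mapsto m_a(\langle\mathbf u^j_i,w\rangle)/a$, for $j=1,\dots,k$ and $i=1,\dots,d$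 in this order, and, if $y^j_i$ denote the answers, outputs a high-dimensional median of the $k$ vectors $\tilde w^j=\sum_{i=1}^d a\,y^j_i\,\mathbf u^j_i$. -/

import Mathlib

open MeasureTheory ProbabilityTheory

/-! ### Statistical query oracles -/

/-- `ℝ^d` with the Euclidean norm. -/
abbrev E (d : ℕ) : Type := EuclideanSpace ℝ (Fin d)

/-- The past queries of an algorithm with the answers it received, oldest first. -/
abbrev History (d : ℕ) : Type := List ((E d → ℝ) × ℝ)

/-- A strategy for answering queries. The answer may depend on everything asked before. -/
abbrev Oracle (d : ℕ) : Type := History d → (E d → ℝ) → ℝ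

/-- `O` is a `STAT_D(τ)` oracle for a distribution `D` on the unit ball: it answers every
(measurable) query with values in `[-1, 1]` on the unit ball up to an additive error `τ`, in an
arbitrary, possibly adversarial and history-dependent way. It promises nothing about anything
else that is asked. -/
def IsSTAT {d : ℕ} (D : Measure (E d)) (τ : ℝ) (O : Oracle d) : Prop :=
  ∀ (h : History d) (φ : E d → ℝ), Measurable φ →
    (∀ w ∈ Metric.closedBall (0 : E d) 1, φ w ∈ Set.Icc (-1 : ℝ) 1) →
      |O h φ - ∫ w, φ w ∂D| ≤ τ

/-! ### Randomized statistical query algorithms on a real RAM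

Programs of a small imperative language. The memory consists of index registers (natural
numbers) and of arrays `A[i][j]` of real numbers, which can be addressed indirectly through the
index registers. Arithmetic on reals is exact and has unit cost; there is no rounding function.
A program contains only rational and natural constants, and one program serves all inputs. -/

namespace RealRAM

/-- Index expressions. -/
inductive IExpr : Type
  | const (n : ℕ)
  | var (x : ℕ)
  | add (e f : IExpr)

/-- Value of an index expression when the index registers hold `σ`. -/
def IExpr.eval (σ : ℕ → ℕ) : IExpr → ℕ
  | .const n => n
  | .var x => σ x
  | .add e f => e.eval σ + f.eval σ

/-- Number of steps for evaluating an index expression. -/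
def IExpr.cost : IExpr → ℕ
  | .const _ => 1
  | .var _ => 1
  | .add e f => e.cost + f.cost + 1

/-- Real expressions. `coord i` is the `i`-th coordinate of the argument `w` of a query function,
`le e f` is `1` if `e ≤ f` and `0` otherwise, and `sum x n e` is the sum of `e` for `x < n`. -/
inductive RExpr : Type
  | const (q : ℚ)
  | ofIndex (i : IExpr)
  | get (A : ℕ) (i j : IExpr)
  | coord (i : IExpr)
  | add (e f : RExpr)
  | sub (e f : RExpr)
  | mul (e f : RExpr)
  | div (e f : RExpr)
  | sqrt (e : RExpr)
  | max (e f : RExpr)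
  | min (e f : RExpr)
  | le (e f : RExpr)
  | sum (x : ℕ) (n : IExpr) (e : RExpr)

open Classical in
/-- Value of a real expression when the index registers hold `σ`, the arrays hold `arr`, and the
argument of the query function is `w`. (Division by zero returns zero.) -/
noncomputable def RExpr.eval {d : ℕ} (arr : ℕ → ℕ → ℕ → ℝ) (w : E d) : (ℕ → ℕ) → RExpr → ℝ
  | _, .const q => (q : ℝ)
  | σ, .ofIndex i => (i.eval σ : ℝ)
  | σ, .get A i j => arr A (i.eval σ) (j.eval σ)
  | σ, .coord i => if h : i.eval σ < d then w ⟨i.eval σ, h⟩ else 0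
  | σ, .add e f => e.eval arr w σ + f.eval arr w σ
  | σ, .sub e f => e.eval arr w σ - f.eval arr w σ
  | σ, .mul e f => e.eval arr w σ * f.eval arr w σ
  | σ, .div e f => e.eval arr w σ / f.eval arr w σ
  | σ, .sqrt e => Real.sqrt (e.eval arr w σ)
  | σ, .max e f => Max.max (e.eval arr w σ) (f.eval arr w σ)
  | σ, .min e f => Min.min (e.eval arr w σ) (f.eval arr w σ)
  | σ, .le e f => if e.eval arr w σ ≤ f.eval arr w σ then 1 else 0
  | σ, .sum x n e => ∑ l ∈ Finset.range (n.eval σ), e.eval arr w (Function.update σ x l)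

/-- Number of steps for evaluating a real expression. -/
def RExpr.cost : (ℕ → ℕ) → RExpr → ℕ
  | _, .const _ => 1
  | _, .ofIndex i => i.cost + 1
  | _, .get _ i j => i.cost + j.cost + 1
  | _, .coord i => i.cost + 1
  | σ, .add e f => e.cost σ + f.cost σ + 1
  | σ, .sub e f => e.cost σ + f.cost σ + 1
  | σ, .mul e f => e.cost σ + f.cost σ + 1
  | σ, .div e f => e.cost σ + f.cost σ + 1
  | σ, .sqrt e => e.cost σ + 1
  | σ, .max e f => e.cost σ + f.cost σ + 1
  | σ, .min e f => e.cost σ + f.cost σ + 1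
  | σ, .le e f => e.cost σ + f.cost σ + 1
  | σ, .sum x n e =>
      n.cost + ∑ l ∈ Finset.range (n.eval σ), (e.cost (Function.update σ x l) + 1) + 1

/-- Commands. `sample A i j` draws a fresh standard normal number into `A[i][j]`; `query A i j e`
asks the oracle for the expectation of the function `w ↦ e` (with the present memory content) and
stores the answer in `A[i][j]`; the tests of `ite` and `loop` are `e < f`. -/
inductive Com : Type
  | skip
  | setIndex (x : ℕ) (e : IExpr)
  | set (A : ℕ) (i j : IExpr) (e : RExpr)
  | sample (A : ℕ) (i j : IExpr)
  | query (A : ℕ) (i j : IExpr) (e : RExpr)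
  | seq (p q : Com)
  | ite (e f : RExpr) (p q : Com)
  | loop (e f : RExpr) (p : Com)

/-- Machine states: memory, number of random numbers drawn so far, queries and answers so far. -/
structure State (d : ℕ) : Type where
  idx : ℕ → ℕ
  arr : ℕ → ℕ → ℕ → ℝ
  coins : ℕ
  hist : History d

/-- The value of a real expression outside of a query (where it has no argument `w` to read). -/
noncomputable def State.val {d : ℕ} (s : State d) (e : RExpr) : ℝ :=
  e.eval s.arr (0 : E d) s.idx

/-- The query function described by a real expression in the state `s`. -/
noncomputable def State.queryFun {d : ℕ} (s : State d) (e : RExpr) : E d → ℝ :=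
  fun w => e.eval s.arr w s.idx

/-- Write the number `v` to `A[i][j]`. -/
def State.write {d : ℕ} (s : State d) (A : ℕ) (i j : IExpr) (v : ℝ) : State d :=
  { s with arr := Function.update s.arr A (Function.update (s.arr A) (i.eval s.idx)
      (Function.update (s.arr A (i.eval s.idx)) (j.eval s.idx) v)) }

/-- `Exec O ω p s s' t`: with the oracle `O` and the random numbers `ω 0, ω 1, …`, the command `p`
started in state `s` halts in state `s'` after `t` steps. A query is charged for the evaluation of
the query function at a point. -/
inductive Exec {d : ℕ} (O : Oracle d) (ω : ℕ → ℝ) : Com → State d → State d → ℕ → Prop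
  | skip (s : State d) : Exec O ω .skip s s 1
  | setIndex (s : State d) (x : ℕ) (e : IExpr) :
      Exec O ω (.setIndex x e) s { s with idx := Function.update s.idx x (e.eval s.idx) }
        (e.cost + 1)
  | set (s : State d) (A : ℕ) (i j : IExpr) (e : RExpr) :
      Exec O ω (.set A i j e) s (s.write A i j (s.val e)) (i.cost + j.cost + e.cost s.idx + 1)
  | sample (s : State d) (A : ℕ) (i j : IExpr) :
      Exec O ω (.sample A i j) s { s.write A i j (ω s.coins) with coins := s.coins + 1 }
        (i.cost + j.cost + 1)
  | query (s : State d) (A : ℕ) (i j : IExpr) (e : RExpr) :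
      Exec O ω (.query A i j e) s
        { s.write A i j (O s.hist (s.queryFun e)) with
          hist := s.hist ++ [(s.queryFun e, O s.hist (s.queryFun e))] }
        (i.cost + j.cost + e.cost s.idx + 1)
  | seq (p q : Com) (s s' s'' : State d) (t t' : ℕ) (hp : Exec O ω p s s' t)
      (hq : Exec O ω q s' s'' t') : Exec O ω (.seq p q) s s'' (t + t')
  | iteTrue (e f : RExpr) (p q : Com) (s s' : State d) (t : ℕ) (h : s.val e < s.val f)
      (hp : Exec O ω p s s' t) :
      Exec O ω (.ite e f p q) s s' (e.cost s.idx + f.cost s.idx + 1 + t)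
  | iteFalse (e f : RExpr) (p q : Com) (s s' : State d) (t : ℕ) (h : ¬ s.val e < s.val f)
      (hq : Exec O ω q s s' t) :
      Exec O ω (.ite e f p q) s s' (e.cost s.idx + f.cost s.idx + 1 + t)
  | loopTrue (e f : RExpr) (p : Com) (s s' s'' : State d) (t t' : ℕ) (h : s.val e < s.val f)
      (hp : Exec O ω p s s' t) (hl : Exec O ω (.loop e f p) s' s'' t') :
      Exec O ω (.loop e f p) s s'' (e.cost s.idx + f.cost s.idx + 1 + t + t')
  | loopFalse (e f : RExpr) (p : Com) (s : State d) (h : ¬ s.val e < s.val f) :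
      Exec O ω (.loop e f p) s s (e.cost s.idx + f.cost s.idx + 1)

/-- Execution is deterministic once the oracle and the random numbers are fixed. -/
theorem Exec.deterministic {d : ℕ} {O : Oracle d} {ω : ℕ → ℝ} {p : Com} {s s₁ s₂ : State d}
    {t₁ t₂ : ℕ} (h₁ : Exec O ω p s s₁ t₁) (h₂ : Exec O ω p s s₂ t₂) : s₁ = s₂ ∧ t₁ = t₂ := by
  induction h₁ generalizing s₂ t₂ with
  | skip | setIndex | set | sample | query => cases h₂; exact ⟨rfl, rfl⟩
  | seq p q s s' s'' t t' hp hq ihp ihq =>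
    cases h₂ with
    | seq _ _ _ r' _ u u' gp gq =>
      obtain ⟨rfl, rfl⟩ := ihp gp
      obtain ⟨rfl, rfl⟩ := ihq gq
      exact ⟨rfl, rfl⟩
  | iteTrue e f p q s s' t h hp ih =>
    cases h₂ with
    | iteTrue _ _ _ _ _ _ _ _ gp => obtain ⟨rfl, rfl⟩ := ih gp; exact ⟨rfl, rfl⟩
    | iteFalse _ _ _ _ _ _ _ h' _ => exact absurd h h'
  | iteFalse e f p q s s' t h hp ih =>
    cases h₂ with
    | iteTrue _ _ _ _ _ _ _ h' _ => exact absurd h' h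
    | iteFalse _ _ _ _ _ _ _ _ gp => obtain ⟨rfl, rfl⟩ := ih gp; exact ⟨rfl, rfl⟩
  | loopTrue e f p s s' s'' t t' h hp hl ihp ihl =>
    cases h₂ with
    | loopTrue _ _ _ _ _ _ _ _ _ gp gl =>
      obtain ⟨rfl, rfl⟩ := ihp gp
      obtain ⟨rfl, rfl⟩ := ihl gl
      exact ⟨rfl, rfl⟩
    | loopFalse _ _ _ _ h' => exact absurd h h'
  | loopFalse e f p s h =>
    cases h₂ with
    | loopTrue _ _ _ _ _ _ _ _ h' _ _ => exact absurd h' h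
    | loopFalse => exact ⟨rfl, rfl⟩

/-- The initial state: the inputs are `d` (in index register `0`), the error parameter `ε` (in
`A₀[0][0]`) and the failure probability `δ` (in `A₀[0][1]`); everything else is zero. -/
noncomputable def init (d : ℕ) (ε δ : ℝ) : State d where
  idx x := if x = 0 then d else 0
  arr A i j := if A = 0 ∧ i = 0 ∧ j = 0 then ε else if A = 0 ∧ i = 0 ∧ j = 1 then δ else 0
  coins := 0
  hist := []

/-- The output: the vector with coordinates `A₁[0][0], …, A₁[0][d-1]`. -/
noncomputable def State.output {d : ℕ} (s : State d) : E d :=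
  WithLp.toLp 2 (fun l : Fin d => s.arr 1 0 l)

/-- The law of the random numbers: independent standard normal. -/
noncomputable def coinLaw : Measure (ℕ → ℝ) :=
  Measure.infinitePi (fun _ : ℕ => gaussianReal 0 1)

end RealRAM

/-! ### Truncated coordinates in a random orthonormal basis, and the median -/

/-- Truncation of a real number to `[-a, a]` (for `0 ≤ a`). -/
noncomputable def truncate (a z : ℝ) : ℝ := max (-a) (min a z)

/-- The query for the `i`-th truncated coordinate in the basis `u`, scaled to `[-1, 1]`. -/
noncomputable def truncQuery {d : ℕ} (u : Fin d → E d) (a : ℝ) (i : Fin d) (w : E d) : ℝ :=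
  truncate a (inner ℝ (u i) w) / a

/-- The vector whose `i`-th coordinate in the basis `u` is `a * y i`. -/
noncomputable def basisEstimate {d : ℕ} (u : Fin d → E d) (a : ℝ) (y : Fin d → ℝ) : E d :=
  ∑ i, (a * y i) • u i

/-- `ν` is the law of a uniformly random orthonormal basis of `ℝ^d`, that is, the (unique)
probability law on orthonormal bases that is invariant under all linear isometries. -/
def IsUniformOrthonormalBasis {d : ℕ} (ν : Measure (Fin d → E d)) : Prop :=
  IsProbabilityMeasure ν ∧ (∀ᵐ u ∂ν, Orthonormal ℝ u) ∧
    ∀ g : E d ≃ₗᵢ[ℝ] E d, ν.map (fun u i => g (u i)) = ν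

/-- The median distance of `x j` to the other points: the smallest `r` such that at least half of
the other points are within `r` of `x j`. -/
noncomputable def medianDist {d k : ℕ} (x : Fin k → E d) (j : Fin k) : ℝ :=
  sInf {r : ℝ | k - 1 ≤ 2 * Set.ncard {l : Fin k | l ≠ j ∧ dist (x j) (x l) ≤ r}}

/-- `x j` is a high-dimensional median of the points `x`: its median distance to the other points
is the smallest. -/
def IsMedianPoint {d k : ℕ} (x : Fin k → E d) (j : Fin k) : Prop :=
  ∀ l : Fin k, medianDist x j ≤ medianDist x l

/-- The halting state `s` is that of a run which queried the truncated coordinates in the bases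
`u 0, …, u (k-1)`, one after the other, and returned a high-dimensional median of the `k` vectors
that the answers describe. -/
def IsTruncationMedianRun {d k : ℕ} (u : Fin k → Fin d → E d) (a : ℝ) (s : RealRAM.State d) :
    Prop :=
  ∃ y : Fin k → Fin d → ℝ,
    s.hist = (List.finRange k).flatMap
        (fun j => (List.finRange d).map fun i => (truncQuery (u j) a i, y j i)) ∧
      ∃ j : Fin k, IsMedianPoint (fun l => basisEstimate (u l) a (y l)) j ∧
        s.output = basisEstimate (u j) a (y j)

/-! ### The Gram-Schmidt process and random orthonormal bases -/

section GramSchmidt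

open InnerProductSpace

variable {F : Type*} [NormedAddCommGroup F] [InnerProductSpace ℝ F]

/-! In a uniformly random orthonormal basis every coordinate of a fixed vector of the unit ball is
sub-Gaussian at scale 1/√d. Truncating coordinates at a level a of order max(1, log(1/ε))/√d
therefore loses, summed over the coordinates and averaged over basis and vector, only 4 exp(1/2 - √d
a) in square (`lintegral_sum_truncation_sq_le`). Jensen and Markov turn this into
`measure_badFrames_le`: with probability at least 15/16 truncation moves the mean by at most ε/6. An
answer has error τ, so a coordinate has error aτ and, the basis being orthonormal, the vector has
error √d a τ, in which the dimension cancels; this too is at most ε/6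
(`norm_mean_sub_basisEstimate_le`).

Whether a basis is bad depends on the basis and on D, never on the answers, so an adaptive adversary
cannot destroy independence. Among k ~ log(1/δ) bases at least half are bad with probability at most
2^(-k) (`measure_half_of_iIndepFun_mem_le`), and otherwise a high-dimensional median is three times
as accurate as the good estimates (`IsMedianPoint.norm_sub_le`).

The rest realizes this on the machine. Gram-Schmidt commutes with isometries, so applied to Gaussian
rows it yields uniform bases (`isUniformOrthonormalBasis_map_gsFrame`). Logarithms are replaced by
counting doublings. Everything else uses only `for` loops: for these, `LCom.run` gives the final
state as a function, and `LCom.exists_exec` supplies halting and a polynomial time bound once and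
for all, so correctness reduces to loop invariants (`CollectInv`). -/

theorem gramSchmidt_congr {f g : ℕ → F} (n : ℕ) (h : ∀ m ≤ n, f m = g m) :
    gramSchmidt ℝ f n = gramSchmidt ℝ g n := by
  induction n using Nat.strong_induction_on with
  | _ n ih =>
    rw [gramSchmidt_def, gramSchmidt_def, h n le_rfl]
    congr 1
    refine Finset.sum_congr rfl fun i hi => ?_
    have hi' : i < n := by simpa using hi
    rw [ih i hi' fun m hm => h m (hm.trans hi'.le)]

theorem gramSchmidtNormed_congr {f g : ℕ → F} (n : ℕ) (h : ∀ m ≤ n, f m = g m) :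
    gramSchmidtNormed ℝ f n = gramSchmidtNormed ℝ g n := by
  rw [gramSchmidtNormed, gramSchmidtNormed, gramSchmidt_congr n h]

theorem starProjection_span_gramSchmidt (f : ℕ → F) (i : ℕ) (x : F) :
    (ℝ ∙ gramSchmidt ℝ f i).starProjection x =
      inner ℝ (gramSchmidtNormed ℝ f i) x • gramSchmidtNormed ℝ f i := by
  rw [Submodule.starProjection_singleton, gramSchmidtNormed, real_inner_smul_left, smul_smul]
  congr 1
  simp only [RCLike.ofReal_real_eq_id, id_eq]
  ring

/-- This is the form evaluated by the program. It needs no independence assumption: a degenerate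
vector is normalized to zero and drops out of the sum. -/
theorem gramSchmidt_eq_sub_sum_normed (f : ℕ → F) (n : ℕ) :
    gramSchmidt ℝ f n = f n - ∑ i ∈ Finset.range n,
      inner ℝ (gramSchmidtNormed ℝ f i) (f n) • gramSchmidtNormed ℝ f i := by
  rw [gramSchmidt_def]
  congr 1
  refine Finset.sum_congr (by ext; simp) fun i _ => starProjection_span_gramSchmidt f i _

/-- The process uses only inner products and linear combinations. This equivariance is what carries
the rotation invariance of the Gaussian over to the basis. -/
theorem gramSchmidt_map_isometry (g : F ≃ₗᵢ[ℝ] F) (f : ℕ → F) (n : ℕ) :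
    gramSchmidt ℝ (fun m => g (f m)) n = g (gramSchmidt ℝ f n) := by
  induction n using Nat.strong_induction_on with
  | _ n ih =>
    rw [gramSchmidt_eq_sub_sum_normed, gramSchmidt_eq_sub_sum_normed, map_sub, map_sum]
    congr 1
    refine Finset.sum_congr rfl fun i hi => ?_
    have : gramSchmidtNormed ℝ (fun m => g (f m)) i = g (gramSchmidtNormed ℝ f i) := by
      rw [gramSchmidtNormed, gramSchmidtNormed, ih i (by simpa using hi), map_smul,
        LinearIsometryEquiv.norm_map]
    rw [this, map_smul, LinearIsometryEquiv.inner_map_map]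

theorem gramSchmidtNormed_map_isometry (g : F ≃ₗᵢ[ℝ] F) (f : ℕ → F) (n : ℕ) :
    gramSchmidtNormed ℝ (fun m => g (f m)) n = g (gramSchmidtNormed ℝ f n) := by
  rw [gramSchmidtNormed, gramSchmidtNormed, gramSchmidt_map_isometry, map_smul,
    LinearIsometryEquiv.norm_map]

theorem orthonormal_gramSchmidtNormed_of_ne_zero {f : ℕ → F} {d : ℕ}
    (h : ∀ i : Fin d, gramSchmidt ℝ f i ≠ 0) :
    Orthonormal ℝ fun i : Fin d => gramSchmidtNormed ℝ f i := by
  have h' : ∀ i : Fin d, gramSchmidtNormed ℝ f i ≠ 0 := fun i => by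
    have := h i
    simp [gramSchmidtNormed, this]
  exact (gramSchmidtNormed_orthonormal' f).comp
    (fun i : Fin d => (⟨(i : ℕ), h' i⟩ : {i | gramSchmidtNormed ℝ f i ≠ 0}))
    fun i j hij => by simpa [Fin.ext_iff] using hij

/-- A vanishing remainder means that the vector equals its projection onto the earlier ones. -/
theorem mem_span_of_gramSchmidt_eq_zero {f : ℕ → F} {n : ℕ} (h : gramSchmidt ℝ f n = 0) :
    f n ∈ Submodule.span ℝ (f '' Set.Iio n) := by
  rw [← span_gramSchmidt_Iio ℝ f n, gramSchmidt_def' ℝ f, h, zero_add]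
  refine Submodule.sum_mem _ fun a ha => ?_
  rw [Submodule.starProjection_singleton]
  exact Submodule.smul_mem _ _ (Submodule.subset_span ⟨a, by simpa using ha, rfl⟩)

variable [MeasurableSpace F] [BorelSpace F] [SecondCountableTopology F]

theorem measurable_gramSchmidt {Ω : Type*} [MeasurableSpace Ω] {f : Ω → ℕ → F}
    (hf : ∀ n, Measurable fun ω => f ω n) (n : ℕ) :
    Measurable fun ω => gramSchmidt ℝ (f ω) n := by
  induction n using Nat.strong_induction_on with
  | _ n ih =>
    simp_rw [gramSchmidt_eq_sub_sum_normed]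
    refine (hf n).sub (Finset.measurable_sum _ fun i hi => ?_)
    have hu : Measurable fun ω => gramSchmidtNormed ℝ (f ω) i := by
      have := ih i (by simpa using hi)
      simp only [gramSchmidtNormed]
      exact (Measurable.inv (by simpa using this.norm)).smul this
    exact (hu.inner (hf n)).smul hu

theorem measurable_gramSchmidtNormed {Ω : Type*} [MeasurableSpace Ω] {f : Ω → ℕ → F}
    (hf : ∀ n, Measurable fun ω => f ω n) (n : ℕ) :
    Measurable fun ω => gramSchmidtNormed ℝ (f ω) n := by
  have := measurable_gramSchmidt hf n
  simp only [gramSchmidtNormed]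
  exact (Measurable.inv (by simpa using this.norm)).smul this

end GramSchmidt

/-! ### Uniform bases from independent Gaussian vectors -/

section RandomBasis

open InnerProductSpace

/-- Extension of a finite sequence of vectors by zero. -/
noncomputable def extendZero {d : ℕ} (v : Fin d → E d) (n : ℕ) : E d :=
  if h : n < d then v ⟨n, h⟩ else 0

theorem extendZero_coe {d : ℕ} (v : Fin d → E d) (i : Fin d) : extendZero v i = v i := by
  simp [extendZero]

theorem measurable_extendZero {d : ℕ} (n : ℕ) :
    Measurable fun v : Fin d → E d => extendZero v n := by
  unfold extendZero
  split_ifs <;> fun_prop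

/-- The normalized Gram-Schmidt process for `d` vectors in `ℝ^d`. -/
noncomputable def gsFrame {d : ℕ} (v : Fin d → E d) (i : Fin d) : E d :=
  gramSchmidtNormed ℝ (extendZero v) i

theorem measurable_gsFrame {d : ℕ} : Measurable (gsFrame (d := d)) :=
  measurable_pi_lambda _ fun i => measurable_gramSchmidtNormed measurable_extendZero i

theorem gsFrame_map_isometry {d : ℕ} (g : E d ≃ₗᵢ[ℝ] E d) (v : Fin d → E d) :
    gsFrame (fun i => g (v i)) = fun i => g (gsFrame v i) := by
  funext i
  have : extendZero (fun i => g (v i)) = fun n => g (extendZero v n) := by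
    funext n
    unfold extendZero
    split_ifs <;> simp
  rw [gsFrame, this, gramSchmidtNormed_map_isometry, gsFrame]

/-- A proper subspace lies in the kernel of a nonzero functional, whose law is a nondegenerate real
Gaussian and has no atoms. -/
theorem stdGaussian_submodule_eq_zero {d : ℕ} (S : Submodule ℝ (E d)) (hS : S ≠ ⊤) :
    stdGaussian (E d) (S : Set (E d)) = 0 := by
  have : Sᗮ ≠ ⊥ := fun h => hS (by rw [← Submodule.orthogonal_orthogonal S, h]; simp)
  obtain ⟨x, hx, hx0⟩ := Submodule.exists_mem_ne_zero_of_ne_bot this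
  set L : StrongDual ℝ (E d) := innerSL ℝ x
  have hsub : (S : Set (E d)) ⊆ L ⁻¹' {0} := fun y hy => by
    simpa [L] using Submodule.inner_left_of_mem_orthogonal hy hx
  refine measure_mono_null hsub ?_
  rw [← Measure.map_apply (by fun_prop) (measurableSet_singleton _),
    IsGaussian.map_eq_gaussianReal L]
  have hv : (Var[L; stdGaussian (E d)]).toNNReal ≠ 0 := by
    rw [variance_dual_stdGaussian]
    simp only [ne_eq, Real.toNNReal_eq_zero, not_le]
    have : ‖L‖ = ‖x‖ := innerSL_apply_norm ℝ x
    rw [this]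
    positivity
  have := nullSingletonClass_gaussianReal (μ := (stdGaussian (E d))[L]) hv
  exact measure_singleton 0

/-- By Fubini all vectors except the one with index i can be frozen. Degeneracy puts that vector
into the span of the others, a null set for its law. -/
theorem ae_gramSchmidt_ne_zero {d : ℕ} (i : Fin d) :
    ∀ᵐ v ∂Measure.pi (fun _ : Fin d => stdGaussian (E d)), gramSchmidt ℝ (extendZero v) i ≠ 0 := by
  obtain _ | n := d
  · exact i.elim0
  set μ := stdGaussian (E (n + 1))
  set S : Set (Fin (n + 1) → E (n + 1)) := {v | gramSchmidt ℝ (extendZero v) i = 0}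
  have hS : MeasurableSet S :=
    measurable_gramSchmidt measurable_extendZero i (measurableSet_singleton _)
  have hmp := (measurePreserving_piFinSuccAbove (fun _ : Fin (n + 1) => μ) i).symm
  have hcompl : Measure.pi (fun _ : Fin (n + 1) => μ) S = 0 := by
    rw [← hmp.measure_preimage hS.nullMeasurableSet, Measure.prod_apply_symm
      (hmp.measurable hS), lintegral_eq_zero_iff
        (measurable_measure_prodMk_right (hmp.measurable hS))]
    refine Filter.Eventually.of_forall fun r => ?_
    set W : Submodule ℝ (E (n + 1)) := Submodule.span ℝ (Set.range r)
    -- There are n frozen vectors in dimension n + 1.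
    have hW : W ≠ ⊤ := fun h => by
      have h1 : Module.finrank ℝ W ≤ n := by
        simpa [Set.finrank] using finrank_range_le_card (R := ℝ) r
      rw [h, finrank_top, finrank_euclideanSpace, Fintype.card_fin] at h1
      omega
    refine measure_mono_null (fun x hx => ?_) (stdGaussian_submodule_eq_zero W hW)
    have hx' := mem_span_of_gramSchmidt_eq_zero hx
    rw [extendZero_coe] at hx'
    have e1 : ∀ l : Fin (n + 1), (MeasurableEquiv.piFinSuccAbove (fun _ => E (n + 1)) i).symm (x, r) l
        = Fin.insertNth (α := fun _ => E (n + 1)) i x r l := fun l => rfl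
    rw [e1, Fin.insertNth_apply_same] at hx'
    refine Submodule.span_mono ?_ hx'
    rintro _ ⟨m, hm, rfl⟩
    have hm' : m < (i : ℕ) := hm
    have hlt : m < n + 1 := hm'.trans i.2
    have : (⟨m, hlt⟩ : Fin (n + 1)) ≠ i := fun h => by simp [← h] at hm'
    obtain ⟨l, hl⟩ := Fin.exists_succAbove_eq this
    refine ⟨l, ?_⟩
    rw [extendZero, dif_pos hlt, e1, ← hl, Fin.insertNth_apply_succAbove]
  rw [ae_iff]
  simpa [S] using hcompl

/-- Orthonormality fails only in the null event of a degenerate vector; invariance combines the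
equivariance of Gram-Schmidt with that of the standard Gaussian. -/
theorem isUniformOrthonormalBasis_map_gsFrame (d : ℕ) :
    IsUniformOrthonormalBasis
      ((Measure.pi fun _ : Fin d => stdGaussian (E d)).map gsFrame) := by
  refine ⟨Measure.isProbabilityMeasure_map measurable_gsFrame.aemeasurable, ?_, fun g => ?_⟩
  · have : MeasurableSet {u : Fin d → E d | Orthonormal ℝ u} := by
      have : {u : Fin d → E d | Orthonormal ℝ u} =
          ⋂ i, ⋂ j, {u | inner ℝ (u i) (u j) = if i = j then (1 : ℝ) else 0} := by
        ext u
        simp [orthonormal_iff_ite]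
      rw [this]
      refine MeasurableSet.iInter fun i => MeasurableSet.iInter fun j => ?_
      exact measurableSet_eq_fun (by fun_prop) (by fun_prop)
    rw [ae_map_iff measurable_gsFrame.aemeasurable this]
    filter_upwards [ae_all_iff.2 (ae_gramSchmidt_ne_zero (d := d))] with v hv
    exact orthonormal_gramSchmidtNormed_of_ne_zero hv
  · have hm : Measurable fun (u : Fin d → E d) i => g (u i) :=
      measurable_pi_lambda _ fun i => g.continuous.measurable.comp (measurable_pi_apply i)
    rw [Measure.map_map hm measurable_gsFrame]
    have : (fun (u : Fin d → E d) i => g (u i)) ∘ gsFrame =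
        gsFrame ∘ fun (v : Fin d → E d) i => g (v i) := by
      funext v
      exact (gsFrame_map_isometry g v).symm
    rw [this, ← Measure.map_map measurable_gsFrame hm]
    congr 1
    rw [Measure.pi_map_pi (fun i => g.continuous.measurable.aemeasurable)]
    simp_rw [stdGaussian_map]

end RandomBasis

/-! ### The random bases drawn by the machine -/

namespace RealRAM

/-- The `i`-th row of `d` random numbers in the `j`-th block of `d` rows. -/
noncomputable def coinRow (d : ℕ) (ω : ℕ → ℝ) (j i : ℕ) : E d :=
  WithLp.toLp 2 fun l : Fin d => ω ((j * d + i) * d + l)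

/-- The basis computed from the `j`-th block of random numbers. -/
noncomputable def coinBasis (d : ℕ) (ω : ℕ → ℝ) (j i : ℕ) : E d :=
  InnerProductSpace.gramSchmidtNormed ℝ (coinRow d ω j) i

theorem measurable_coinRow (d j i : ℕ) : Measurable fun ω => coinRow d ω j i := by
  unfold coinRow
  fun_prop

theorem coinBasis_eq_gsFrame (d : ℕ) (ω : ℕ → ℝ) (j : ℕ) :
    (fun i : Fin d => coinBasis d ω j i) = gsFrame fun i : Fin d => coinRow d ω j i := by
  funext i
  refine gramSchmidtNormed_congr _ fun m hm => ?_
  rw [extendZero, dif_pos (hm.trans_lt i.2)]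

instance : IsProbabilityMeasure coinLaw := by
  unfold coinLaw
  infer_instance

/-- Distinct triples (j, i, l) read distinct coins, so the entries are independent standard normals;
currying twice groups them into rows and blocks. -/
theorem map_coinLaw_coinRow (d k : ℕ) :
    coinLaw.map (fun ω (j : Fin k) (i : Fin d) => coinRow d ω j i) =
      Measure.pi fun _ : Fin k => Measure.pi fun _ : Fin d => stdGaussian (E d) := by
  have hinj : Function.Injective fun p : (Fin k × Fin d) × Fin d =>
      ((p.1.1 * d + p.1.2) * d + p.2 : ℕ) := by
    rintro ⟨⟨j, i⟩, l⟩ ⟨⟨j', i'⟩, l'⟩ h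
    simp only at h
    have hd : 0 < d := i.pos
    -- Uniqueness of division with remainder, used once for each of the two levels of the index.
    have aux : ∀ a b (x y : Fin d), a * d + (x : ℕ) = b * d + y → a = b ∧ x = y := by
      intro a b x y hxy
      have h1 : (a * d + (x : ℕ)) / d = (b * d + y) / d := by rw [hxy]
      have h2 : (a * d + (x : ℕ)) % d = (b * d + y) % d := by rw [hxy]
      rw [Nat.mul_comm a, Nat.mul_comm b, Nat.mul_add_mod, Nat.mul_add_mod, Nat.mod_eq_of_lt x.2,
        Nat.mod_eq_of_lt y.2] at h2
      rw [Nat.mul_comm a, Nat.mul_comm b, Nat.mul_add_div hd, Nat.mul_add_div hd,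
        Nat.div_eq_of_lt x.2, Nat.div_eq_of_lt y.2] at h1
      exact ⟨by simpa using h1, Fin.ext h2⟩
    obtain ⟨h1, rfl⟩ := aux _ _ _ _ h
    obtain ⟨h2, rfl⟩ := aux _ _ _ _ h1
    rw [Fin.ext h2]
  have hind : iIndepFun (fun (n : ℕ) (ω : ℕ → ℝ) => ω n) coinLaw :=
    iIndepFun_infinitePi (X := fun _ x => x) fun _ => measurable_id
  have hlaw := (hind.precomp hinj).map_fun_eq_infinitePi_map
    (fun p => measurable_pi_apply _)
  have heval : ∀ n, coinLaw.map (fun ω : ℕ → ℝ => ω n) = gaussianReal 0 1 := fun n =>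
    Measure.infinitePi_map_eval _ n
  simp only [heval] at hlaw
  have h1 := Measure.infinitePi_map_curry
    (fun (_ : Fin k × Fin d) (_ : Fin d) => gaussianReal 0 1)
  have h2 := Measure.infinitePi_map_curry
    (fun (_ : Fin k) (_ : Fin d) => Measure.infinitePi fun _ : Fin d => gaussianReal 0 1)
  rw [← hlaw, Measure.map_map (by fun_prop) (by fun_prop)] at h1
  rw [← h1, Measure.map_map (by fun_prop) (by fun_prop)] at h2
  have h3 : Measurable fun (x : Fin k → Fin d → Fin d → ℝ) j i => WithLp.toLp 2 (x j i) := by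
    fun_prop
  have h4 := congrArg (Measure.map fun (x : Fin k → Fin d → Fin d → ℝ) j i =>
    WithLp.toLp 2 (x j i)) h2
  rw [Measure.map_map h3 (by fun_prop)] at h4
  refine Eq.trans ?_ (h4.trans ?_)
  · rfl
  · simp only [Measure.infinitePi_eq_pi]
    rw [Measure.pi_map_pi (f := fun (_ : Fin k) (y : Fin d → Fin d → ℝ) i => WithLp.toLp 2 (y i))
      (fun _ => Measurable.aemeasurable (by fun_prop))]
    congr 1
    funext j
    rw [Measure.pi_map_pi (f := fun (_ : Fin d) (y : Fin d → ℝ) => WithLp.toLp 2 y)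
      (fun _ => Measurable.aemeasurable (by fun_prop))]
    simp_rw [map_pi_eq_stdGaussian]

theorem measurable_coinBasis (d j : ℕ) :
    Measurable fun ω (i : Fin d) => coinBasis d ω j i := by
  rw [funext fun ω => coinBasis_eq_gsFrame d ω j]
  exact measurable_gsFrame.comp (measurable_pi_lambda _ fun i => measurable_coinRow d j i)

theorem iIndepFun_coinRow (d k : ℕ) :
    iIndepFun (fun (j : Fin k) ω (i : Fin d) => coinRow d ω j i) coinLaw := by
  have hm : ∀ j : Fin k, Measurable fun ω (i : Fin d) => coinRow d ω j i :=
    fun j => measurable_pi_lambda _ fun i => measurable_coinRow d j i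
  rw [iIndepFun_iff_map_fun_eq_pi_map fun j => (hm j).aemeasurable, map_coinLaw_coinRow]
  congr 1
  funext j
  have := congrArg (Measure.map fun x => x j) (map_coinLaw_coinRow d k)
  rw [Measure.map_map (measurable_pi_apply j) (measurable_pi_lambda _ hm),
    (measurePreserving_eval _ j).map_eq] at this
  exact this.symm

theorem iIndepFun_coinBasis (d k : ℕ) :
    iIndepFun (fun (j : Fin k) ω (i : Fin d) => coinBasis d ω j i) coinLaw := by
  rw [funext fun j : Fin k => funext fun ω => coinBasis_eq_gsFrame d ω j]
  exact (iIndepFun_coinRow d k).comp (fun _ => gsFrame) fun _ => measurable_gsFrame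

theorem isUniformOrthonormalBasis_coinBasis (d j : ℕ) :
    IsUniformOrthonormalBasis (coinLaw.map fun ω (i : Fin d) => coinBasis d ω j i) := by
  rw [funext fun ω => coinBasis_eq_gsFrame d ω j]
  have hm : Measurable fun ω (i : Fin d) => coinRow d ω j i :=
    measurable_pi_lambda _ fun i => measurable_coinRow d j i
  have h : coinLaw.map (fun ω (i : Fin d) => coinRow d ω j i) =
      Measure.pi fun _ : Fin d => stdGaussian (E d) := by
    -- Block j is the last of the first j + 1 blocks, so its law is a marginal of the joint law.
    have := congrArg (Measure.map fun x => x (Fin.last j)) (map_coinLaw_coinRow d (j + 1))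
    have hm' : Measurable fun ω (j' : Fin (j + 1)) (i : Fin d) => coinRow d ω j' i :=
      measurable_pi_lambda _ fun j' => measurable_pi_lambda _ fun i => measurable_coinRow d j' i
    rw [Measure.map_map (measurable_pi_apply _) hm', (measurePreserving_eval _ _).map_eq] at this
    simpa [Function.comp_def] using this
  have := isUniformOrthonormalBasis_map_gsFrame d
  rwa [← h, Measure.map_map measurable_gsFrame hm] at this

end RealRAM

/-! ### Truncation errors in a uniformly random orthonormal basis -/

theorem exists_linearIsometryEquiv_apply_eq {d : ℕ} {v w : E d} (h : ‖v‖ = ‖w‖) :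
    ∃ g : E d ≃ₗᵢ[ℝ] E d, g v = w :=
  ⟨(ℝ ∙ (v - w))ᗮ.reflection, Submodule.reflection_sub h⟩

/-- Invariance moves an isometry from the basis to the vector, and a reflection carries any vector
to any other of the same norm. Hence only the norm of the vector matters. -/
theorem IsUniformOrthonormalBasis.lintegral_comp_inner_eq {d : ℕ} {ν : Measure (Fin d → E d)}
    (hν : IsUniformOrthonormalBasis ν) (i : Fin d) {v w : E d} (h : ‖v‖ = ‖w‖)
    {f : ℝ → ENNReal} (hf : Measurable f) :
    ∫⁻ u, f (inner ℝ (u i) w) ∂ν = ∫⁻ u, f (inner ℝ (u i) v) ∂ν := by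
  obtain ⟨g, rfl⟩ := exists_linearIsometryEquiv_apply_eq h
  have hm : Measurable fun (u : Fin d → E d) i => g (u i) :=
    measurable_pi_lambda _ fun i => g.continuous.measurable.comp (measurable_pi_apply i)
  conv_lhs => rw [← hν.2.2 g]
  rw [lintegral_map (by fun_prop) hm]
  simp

theorem sum_exp_inner_signs {d : ℕ} (x : E d) (r : ℝ) :
    ∑ s : Fin d → Bool, Real.exp (inner ℝ x (WithLp.toLp 2 fun l => if s l then r else -r)) =
      2 ^ d * ∏ l, Real.cosh (r * x l) := by
  have h : ∀ s : Fin d → Bool,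
      Real.exp (inner ℝ x (WithLp.toLp 2 fun l => if s l then r else -r)) =
        ∏ l, Real.exp ((if s l then r else -r) * x l) := fun s => by
    rw [← Real.exp_sum]
    congr 1
  simp_rw [h]
  rw [← Fintype.prod_sum (fun (l : Fin d) (b : Bool) => Real.exp ((if b then r else -r) * x l))]
  have h2 : ∀ l : Fin d, ∑ b : Bool, Real.exp ((if b then r else -r) * x l) =
      2 * Real.cosh (r * x l) := fun l => by
    rw [Fintype.sum_bool, Real.cosh_eq]
    simp
    ring
  simp_rw [h2]
  rw [Finset.prod_mul_distrib]
  simp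

theorem prod_cosh_le {d : ℕ} {x : E d} (hx : ‖x‖ = 1) {r : ℝ} (hr : |r| ≤ 1) :
    ∏ l, Real.cosh (r * x l) ≤ Real.exp (1 / 2) := by
  calc ∏ l, Real.cosh (r * x l) ≤ ∏ l, Real.exp ((r * x l) ^ 2 / 2) :=
        Finset.prod_le_prod (fun _ _ => (Real.cosh_pos _).le) fun _ _ => Real.cosh_le_exp_half_sq _
    _ = Real.exp (r ^ 2 * ‖x‖ ^ 2 / 2) := by
        rw [← Real.exp_sum, EuclideanSpace.norm_sq_eq, Finset.mul_sum, Finset.sum_div]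
        simp [mul_pow]
    _ ≤ Real.exp (1 / 2) := by
        rw [hx]
        have := (sq_le_one_iff_abs_le_one r).2 hr
        gcongr
        linarith

/-- Sub-Gaussianity without computing the law of a coordinate: √d w may be exchanged for any of the
2^d vectors with entries ±‖w‖. Averaged over the signs, the exponential becomes a product of
hyperbolic cosines, bounded by cosh t ≤ exp(t²/2) for each single unit vector of the basis. -/
theorem IsUniformOrthonormalBasis.lintegral_exp_inner_le {d : ℕ} {ν : Measure (Fin d → E d)}
    (hν : IsUniformOrthonormalBasis ν) (i : Fin d) {w : E d} (hw : ‖w‖ ≤ 1) :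
    ∫⁻ u, ENNReal.ofReal (Real.exp (√d * inner ℝ (u i) w)) ∂ν ≤
      ENNReal.ofReal (Real.exp (1 / 2)) := by
  have := hν.1
  set I := ∫⁻ u, ENNReal.ofReal (Real.exp (√d * inner ℝ (u i) w)) ∂ν
  -- Both √d w and the sign vector have norm √d ‖w‖.
  have hI : ∀ s : Fin d → Bool, I = ∫⁻ u, ENNReal.ofReal (Real.exp
      (inner ℝ (u i) (WithLp.toLp 2 fun l => if s l then ‖w‖ else -‖w‖))) ∂ν := fun s => by
    have h1 : I = ∫⁻ u, ENNReal.ofReal (Real.exp (inner ℝ (u i) (√d • w))) ∂ν := by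
      simp [I, inner_smul_right]
    rw [h1]
    refine hν.lintegral_comp_inner_eq i ?_ (f := fun z => ENNReal.ofReal (Real.exp z))
      (by fun_prop)
    rw [EuclideanSpace.norm_eq, norm_smul]
    simp [abs_of_nonneg (Real.sqrt_nonneg _)]
  have hsum : ∑ _s : Fin d → Bool, I ≤ 2 ^ d * ENNReal.ofReal (Real.exp (1 / 2)) := by
    rw [Finset.sum_congr rfl fun s _ => hI s, ← lintegral_finsetSum _ (fun s _ => by fun_prop)]
    calc _ ≤ ∫⁻ _u, 2 ^ d * ENNReal.ofReal (Real.exp (1 / 2)) ∂ν := by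
          refine lintegral_mono_ae ?_
          filter_upwards [hν.2.1] with u hu
          rw [← ENNReal.ofReal_sum_of_nonneg fun _ _ => (Real.exp_pos _).le,
            sum_exp_inner_signs, ENNReal.ofReal_mul (by positivity)]
          have : ENNReal.ofReal (2 ^ d) = 2 ^ d := by
            rw [ENNReal.ofReal_pow zero_le_two]; simp
          rw [this]
          gcongr
          exact prod_cosh_le (hu.1 i) (by simpa using hw)
      _ = _ := by simp
  simp only [Finset.sum_const, Finset.card_univ, Fintype.card_pi, Fintype.card_bool,
    Finset.prod_const, Fintype.card_fin, nsmul_eq_mul] at hsum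
  push_cast at hsum
  exact (ENNReal.mul_le_mul_iff_right (by simp) (by simp)).1 hsum

theorem continuous_truncate (a : ℝ) : Continuous (truncate a) := by
  unfold truncate
  fun_prop

theorem abs_truncate_le {a : ℝ} (ha : 0 ≤ a) (z : ℝ) : |truncate a z| ≤ a := by
  unfold truncate
  rw [abs_le]
  exact ⟨le_max_left _ _, max_le (by linarith) (min_le_left _ _)⟩

theorem abs_sub_truncate_le {a : ℝ} (ha : 0 ≤ a) (z : ℝ) : |z - truncate a z| ≤ |z| := by
  unfold truncate
  rcases le_total z (-a) with h | h
  · rw [min_eq_right (by linarith), max_eq_left h, abs_of_nonpos (by linarith),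
      abs_of_nonpos (by linarith)]
    linarith
  · rcases le_total a z with h' | h'
    · rw [min_eq_left h', max_eq_right (by linarith), abs_of_nonneg (by linarith),
        abs_of_nonneg (by linarith)]
      linarith
    · rw [min_eq_right h', max_eq_right h]
      simp

theorem sq_le_two_mul_exp {x : ℝ} (hx : 0 ≤ x) : x ^ 2 ≤ 2 * Real.exp x := by
  have := Real.quadratic_le_exp_of_nonneg hx
  linarith

/-- The scaled excess t = b(|z| - a), where positive, satisfies t² ≤ 2 exp t; adding both
exponentials covers the two tails at once. -/
theorem sq_mul_sub_truncate_le {a b : ℝ} (ha : 0 ≤ a) (hb : 0 ≤ b) (z : ℝ) :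
    (b * (z - truncate a z)) ^ 2 ≤
      2 * Real.exp (-(b * a)) * (Real.exp (b * z) + Real.exp (b * (-z))) := by
  have key : ∀ z, a ≤ z → (b * (z - a)) ^ 2 ≤
      2 * Real.exp (-(b * a)) * (Real.exp (b * z) + Real.exp (b * (-z))) := fun z hz => by
    refine (sq_le_two_mul_exp (mul_nonneg hb (by linarith))).trans ?_
    have : Real.exp (b * (z - a)) = Real.exp (-(b * a)) * Real.exp (b * z) := by
      rw [← Real.exp_add]; ring_nf
    rw [this, mul_add, mul_assoc]
    have : 0 < 2 * Real.exp (-(b * a)) * Real.exp (b * (-z)) := by positivity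
    linarith
  rcases le_total z (-a) with h | h
  · have h1 : truncate a z = -a := by
      rw [truncate, min_eq_right (by linarith), max_eq_left h]
    have h2 := key (-z) (by linarith)
    rw [neg_neg, add_comm (Real.exp (b * -z))] at h2
    rw [h1]
    refine le_trans (le_of_eq ?_) h2
    ring
  · rcases le_total a z with h' | h'
    · have h1 : truncate a z = a := by
        rw [truncate, min_eq_left h', max_eq_right (by linarith)]
      rw [h1]
      exact key z h'
    · have h1 : truncate a z = z := by
        rw [truncate, min_eq_right h', max_eq_right h]
      rw [h1]
      rw [sub_self, mul_zero, zero_pow two_ne_zero]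
      positivity

/-! ### The effect of truncation on the mean of a distribution -/

section Distribution

theorem ae_norm_le_one {d : ℕ} {D : Measure (E d)}
    (hD : D (Metric.closedBall 0 1)ᶜ = 0) : ∀ᵐ w ∂D, ‖w‖ ≤ 1 := by
  have : ∀ᵐ w ∂D, w ∈ Metric.closedBall (0 : E d) 1 := hD
  simpa using this

variable {d : ℕ} {D : Measure (E d)} [IsProbabilityMeasure D]

theorem memLp_two_sub_truncate (hD : D (Metric.closedBall 0 1)ᶜ = 0) (x : E d) {a : ℝ}
    (ha : 0 ≤ a) :
    MemLp (fun w => inner ℝ x w - truncate a (inner ℝ x w)) 2 D := by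
  have hc := continuous_truncate a
  refine MemLp.of_bound (by fun_prop) ‖x‖ ?_
  filter_upwards [ae_norm_le_one hD] with w hw
  refine (abs_sub_truncate_le ha _).trans ((abs_real_inner_le_norm _ _).trans ?_)
  nlinarith [norm_nonneg x]

/-- After exchanging the integrals, w is fixed and the exponential moment at b = √d applies. The
factor b² on the left yields 1/d for each coordinate, which the sum over d coordinates cancels. -/
theorem lintegral_sum_truncation_sq_le {ν : Measure (Fin d → E d)}
    (hν : IsUniformOrthonormalBasis ν) (hD : D (Metric.closedBall 0 1)ᶜ = 0) {a : ℝ}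
    (ha : 0 ≤ a) :
    ∫⁻ u, ∑ i, ∫⁻ w, ENNReal.ofReal ((inner ℝ (u i) w - truncate a (inner ℝ (u i) w)) ^ 2) ∂D ∂ν ≤
      ENNReal.ofReal (4 * Real.exp (1 / 2 - √d * a)) := by
  have := hν.1
  have hc := (continuous_truncate a).measurable
  have hm : ∀ i : Fin d, Measurable fun p : (Fin d → E d) × E d =>
      ENNReal.ofReal ((inner ℝ (p.1 i) p.2 - truncate a (inner ℝ (p.1 i) p.2)) ^ 2) := by
    intro i
    fun_prop
  rw [lintegral_finsetSum _ fun i _ => (hm i).lintegral_prod_right']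
  have hi : ∀ i : Fin d, ∫⁻ u, ∫⁻ w, ENNReal.ofReal
      ((inner ℝ (u i) w - truncate a (inner ℝ (u i) w)) ^ 2) ∂D ∂ν ≤
      ENNReal.ofReal (4 * Real.exp (1 / 2 - √d * a) / d) := by
    intro i
    have hd : (0 : ℝ) < d := by exact_mod_cast i.pos
    rw [lintegral_lintegral_swap (hm i).aemeasurable]
    calc _ ≤ ∫⁻ _w, ENNReal.ofReal (4 * Real.exp (1 / 2 - √d * a) / d) ∂D := by
          refine lintegral_mono_ae ?_
          filter_upwards [ae_norm_le_one hD] with w hw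
          calc _ ≤ ∫⁻ u, ENNReal.ofReal (2 * Real.exp (-(√d * a)) / d) *
                (ENNReal.ofReal (Real.exp (√d * inner ℝ (u i) w)) +
                  ENNReal.ofReal (Real.exp (√d * inner ℝ (u i) (-w)))) ∂ν := by
                refine lintegral_mono fun u => ?_
                rw [← ENNReal.ofReal_add (Real.exp_pos _).le (Real.exp_pos _).le,
                  ← ENNReal.ofReal_mul (by positivity)]
                refine ENNReal.ofReal_le_ofReal ?_
                have h1 := sq_mul_sub_truncate_le ha (Real.sqrt_nonneg d) (inner ℝ (u i) w)
                rw [mul_pow, Real.sq_sqrt hd.le, mul_comm, ← le_div_iff₀ hd] at h1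
                rw [inner_neg_right, div_mul_eq_mul_div]
                exact h1
            _ ≤ ENNReal.ofReal (2 * Real.exp (-(√d * a)) / d) *
                (ENNReal.ofReal (Real.exp (1 / 2)) + ENNReal.ofReal (Real.exp (1 / 2))) := by
                rw [lintegral_const_mul _ (by fun_prop), lintegral_add_left (by fun_prop)]
                gcongr
                · exact hν.lintegral_exp_inner_le i hw
                · exact hν.lintegral_exp_inner_le i (by simpa using hw)
            _ = _ := by
                rw [← ENNReal.ofReal_add (Real.exp_pos _).le (Real.exp_pos _).le,
                  ← ENNReal.ofReal_mul (by positivity)]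
                congr 1
                rw [sub_eq_add_neg, Real.exp_add]
                ring
      _ = _ := by simp
  refine (Finset.sum_le_sum fun i _ => hi i).trans ?_
  rw [Finset.sum_const, Finset.card_univ, Fintype.card_fin, nsmul_eq_mul]
  rcases Nat.eq_zero_or_pos d with rfl | hd
  · simp
  · have hd' : (0 : ℝ) < d := by exact_mod_cast hd
    rw [← ENNReal.ofReal_natCast, ← ENNReal.ofReal_mul hd'.le]
    refine ENNReal.ofReal_le_ofReal (le_of_eq ?_)
    field_simp

/-- The bases in which the truncation at `a` moves the mean of `D` by more than `ρ`. -/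
def badFrames {d : ℕ} (D : Measure (E d)) (a ρ : ℝ) : Set (Fin d → E d) :=
  {u | ρ ^ 2 < ∑ i, (∫ w, (inner ℝ (u i) w - truncate a (inner ℝ (u i) w)) ∂D) ^ 2}

theorem measurableSet_badFrames (D : Measure (E d)) [IsProbabilityMeasure D] (a ρ : ℝ) :
    MeasurableSet (badFrames D a ρ) := by
  have hc := (continuous_truncate a).measurable
  refine measurableSet_lt measurable_const (Finset.measurable_sum _ fun i _ => ?_)
  have : Measurable fun p : (Fin d → E d) × E d =>
      inner ℝ (p.1 i) p.2 - truncate a (inner ℝ (p.1 i) p.2) := by fun_prop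
  exact (this.stronglyMeasurable.integral_prod_right'.measurable).pow_const 2

/-- Jensen, in the form that a variance is nonnegative, bounds the shift of the mean by the mean
square truncation error; Markov's inequality does the rest. -/
theorem measure_badFrames_le {ν : Measure (Fin d → E d)}
    (hν : IsUniformOrthonormalBasis ν) (hD : D (Metric.closedBall 0 1)ᶜ = 0) {a ρ : ℝ}
    (ha : 0 ≤ a) (hρ : 0 < ρ) :
    ν (badFrames D a ρ) ≤ ENNReal.ofReal (4 * Real.exp (1 / 2 - √d * a) / ρ ^ 2) := by
  have hjensen : ∀ x : E d,
      ENNReal.ofReal ((∫ w, (inner ℝ x w - truncate a (inner ℝ x w)) ∂D) ^ 2) ≤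
        ∫⁻ w, ENNReal.ofReal ((inner ℝ x w - truncate a (inner ℝ x w)) ^ 2) ∂D := fun x => by
    have hL := memLp_two_sub_truncate hD x ha
    rw [← ofReal_integral_eq_lintegral_ofReal hL.integrable_sq
      (Filter.Eventually.of_forall fun _ => sq_nonneg _)]
    refine ENNReal.ofReal_le_ofReal ?_
    have h1 := variance_nonneg (fun w => inner ℝ x w - truncate a (inner ℝ x w)) D
    rw [variance_eq_sub hL] at h1
    simpa using h1
  have hsub : badFrames D a ρ ⊆ {u | ENNReal.ofReal (ρ ^ 2) ≤ ∑ i, ∫⁻ w,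
      ENNReal.ofReal ((inner ℝ (u i) w - truncate a (inner ℝ (u i) w)) ^ 2) ∂D} := fun u hu => by
    refine le_trans (ENNReal.ofReal_le_ofReal (le_of_lt hu)) ?_
    rw [ENNReal.ofReal_sum_of_nonneg fun _ _ => sq_nonneg _]
    exact Finset.sum_le_sum fun i _ => hjensen (u i)
  refine (measure_mono hsub).trans ?_
  have hc := (continuous_truncate a).measurable
  have hm : ∀ i : Fin d, Measurable fun p : (Fin d → E d) × E d =>
      ENNReal.ofReal ((inner ℝ (p.1 i) p.2 - truncate a (inner ℝ (p.1 i) p.2)) ^ 2) := by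
    intro i
    fun_prop
  refine (meas_ge_le_lintegral_div
    (Finset.measurable_sum _ fun i _ => (hm i).lintegral_prod_right').aemeasurable
    (by simpa using hρ.ne') (by simp)).trans ?_
  rw [ENNReal.ofReal_div_of_pos (by positivity)]
  exact ENNReal.div_le_div_right (lintegral_sum_truncation_sq_le hν hD ha) _

/-- In a good basis, sufficiently accurate answers determine the mean. -/
theorem norm_mean_sub_basisEstimate_le (hD : D (Metric.closedBall 0 1)ᶜ = 0)
    {u : Fin d → E d} (hu : Orthonormal ℝ u) {a ρ τ : ℝ} (ha : 0 < a) (hρ : 0 ≤ ρ)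
    (hτ : 0 ≤ τ) (hgood : u ∉ badFrames D a ρ) {y : Fin d → ℝ}
    (hy : ∀ i, |y i - ∫ w, truncQuery u a i w ∂D| ≤ τ) :
    ‖(∫ w, w ∂D) - basisEstimate u a y‖ ≤ ρ + √d * a * τ := by
  have hint : Integrable (fun w : E d => w) D :=
    Integrable.of_bound (by fun_prop) 1 (ae_norm_le_one hD)
  have hb : ⊤ ≤ Submodule.span ℝ (Set.range u) := by
    rw [hu.linearIndependent.span_eq_top_of_card_eq_finrank' (by simp)]
  set b := OrthonormalBasis.mk hu hb
  have hbu : ∀ i, b i = u i := fun i => by simp [b]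
  have hc := (continuous_truncate a).measurable
  have hiq : ∀ i, Integrable (fun w => truncQuery u a i w) D := fun i => by
    unfold truncQuery
    refine Integrable.of_bound (Measurable.aestronglyMeasurable (by fun_prop)) 1
      (Filter.Eventually.of_forall fun w => ?_)
    rw [Real.norm_eq_abs, abs_div, abs_of_pos ha, div_le_one ha]
    exact abs_truncate_le ha.le _
  -- In the coordinates of the basis the error is p + q, with p due to truncation and q to inexact
  -- answers.
  set p : E d := WithLp.toLp 2 fun i => ∫ w, (inner ℝ (u i) w - truncate a (inner ℝ (u i) w)) ∂D
  set q : E d := WithLp.toLp 2 fun i => a * ((∫ w, truncQuery u a i w ∂D) - y i)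
  have hrepr : b.repr ((∫ w, w ∂D) - basisEstimate u a y) = p + q := by
    ext i
    rw [map_sub, PiLp.sub_apply, b.repr_apply_apply, b.repr_apply_apply, hbu, basisEstimate,
      inner_sum, PiLp.add_apply]
    have h1 : ∑ l, inner ℝ (u i) ((a * y l) • u l) = a * y i := by
      simp_rw [inner_smul_right, orthonormal_iff_ite.1 hu]
      simp
    have h2 : ∫ w, inner ℝ (u i) w ∂D = inner ℝ (u i) (∫ w, w ∂D) :=
      integral_inner hint (u i)
    have h3 : ∫ w, (inner ℝ (u i) w - truncate a (inner ℝ (u i) w)) ∂D =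
        inner ℝ (u i) (∫ w, w ∂D) - a * ∫ w, truncQuery u a i w ∂D := by
      rw [← h2, ← integral_const_mul, ← integral_sub (hint.const_inner (u i))
        ((hiq i).const_mul a)]
      refine integral_congr_ae (Filter.Eventually.of_forall fun w => ?_)
      simp only [truncQuery]
      field_simp
    simp only [p, q]
    rw [h1, h3]
    ring
  rw [← b.repr.norm_map, hrepr]
  refine (norm_add_le _ _).trans (add_le_add ?_ ?_)
  · rw [EuclideanSpace.norm_eq]
    refine Real.sqrt_le_iff.2 ⟨hρ, ?_⟩
    have : ¬ _ := hgood
    simp only [badFrames, Set.mem_ofPred_eq, not_lt] at this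
    simpa [p] using this
  · rw [EuclideanSpace.norm_eq]
    refine Real.sqrt_le_iff.2 ⟨by positivity, ?_⟩
    have : ∀ i, ‖q i‖ ^ 2 ≤ (a * τ) ^ 2 := fun i => by
      have h1 : ‖q i‖ = a * |y i - ∫ w, truncQuery u a i w ∂D| := by
        simp only [q, Real.norm_eq_abs, abs_mul, abs_of_pos ha]
        rw [abs_sub_comm]
      rw [h1]
      have := hy i
      gcongr
    refine (Finset.sum_le_sum fun i _ => this i).trans ?_
    simp only [Finset.sum_const, Finset.card_univ, Fintype.card_fin, nsmul_eq_mul, mul_pow,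
      Real.sq_sqrt (Nat.cast_nonneg d)]
    rw [mul_assoc]

end Distribution

/-! ### High-dimensional medians and majorities of independent events -/

section Median

variable {d k : ℕ}

open Classical in
/-- At least half of the points other than `x j` are within distance `dist (x j) (x l)` of `x j`
(here `x j` itself is counted on both sides). -/
def IsCentralPair (x : Fin k → E d) (j l : Fin k) : Prop :=
  k + 1 ≤ 2 * (Finset.univ.filter fun l' => dist (x j) (x l') ≤ dist (x j) (x l)).card

-- Replaces an infimum over reals by a minimum over the finitely many occurring distances, which a
-- program can find by comparisons. Counting the point itself changes k - 1 ≤ 2n into k + 1 ≤ 2(n +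
-- 1).
open Classical in
theorem isLeast_medianDist (x : Fin k → E d) (j : Fin k) :
    IsLeast {r | ∃ l, IsCentralPair x j l ∧ r = dist (x j) (x l)} (medianDist x j) := by
  set T := Finset.univ.filter fun l => IsCentralPair x j l
  have hT : T.Nonempty := by
    obtain ⟨l, -, hl⟩ := Finset.exists_max_image Finset.univ (fun l => dist (x j) (x l))
      ⟨j, Finset.mem_univ j⟩
    refine ⟨l, Finset.mem_filter.2 ⟨Finset.mem_univ _, ?_⟩⟩
    have h1 : (Finset.univ.filter fun l' => dist (x j) (x l') ≤ dist (x j) (x l)) = Finset.univ :=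
      Finset.filter_true_of_mem hl
    have := j.pos
    rw [IsCentralPair, h1, Finset.card_univ, Fintype.card_fin]
    omega
  obtain ⟨l, hlT, hl⟩ := Finset.exists_min_image T (fun l => dist (x j) (x l)) hT
  have hlC : IsCentralPair x j l := (Finset.mem_filter.1 hlT).2
  have hmin : ∀ l', IsCentralPair x j l' → dist (x j) (x l) ≤ dist (x j) (x l') := fun l' h =>
    hl l' (Finset.mem_filter.2 ⟨Finset.mem_univ _, h⟩)
  suffices h : medianDist x j = dist (x j) (x l) by
    rw [h]
    refine ⟨⟨l, hlC, rfl⟩, ?_⟩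
    rintro _ ⟨l', hl', rfl⟩
    exact hmin l' hl'
  rcases Nat.lt_or_ge 1 k with hk | hk
  · have hset : {r : ℝ | k - 1 ≤ 2 * Set.ncard {l : Fin k | l ≠ j ∧ dist (x j) (x l) ≤ r}} =
        Set.Ici (dist (x j) (x l)) := by
      ext r
      have hn : Set.ncard {l : Fin k | l ≠ j ∧ dist (x j) (x l) ≤ r} =
          ((Finset.univ.filter fun l' => dist (x j) (x l') ≤ r).erase j).card := by
        rw [← Set.ncard_coe_finset]
        congr 1
        ext l'
        simp [and_comm]
      rw [Set.mem_ofPred_eq, hn, Set.mem_Ici]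
      constructor
      · intro h
        have hne : ((Finset.univ.filter fun l' => dist (x j) (x l') ≤ r).erase j).Nonempty := by
          rw [← Finset.card_pos]
          omega
        obtain ⟨l₁, hl₁, hmax⟩ := Finset.exists_max_image _ (fun l => dist (x j) (x l)) hne
        have hl₁' : dist (x j) (x l₁) ≤ r := by
          have := Finset.mem_of_mem_erase hl₁
          simpa using this
        refine le_trans (hmin l₁ ?_) hl₁'
        have hsub : insert j ((Finset.univ.filter fun l' => dist (x j) (x l') ≤ r).erase j) ⊆
            Finset.univ.filter fun l' => dist (x j) (x l') ≤ dist (x j) (x l₁) := by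
          intro l' hl'
          refine Finset.mem_filter.2 ⟨Finset.mem_univ _, ?_⟩
          rcases Finset.mem_insert.1 hl' with rfl | h'
          · simp
          · exact hmax _ h'
        have hc := Finset.card_le_card hsub
        rw [Finset.card_insert_of_notMem (by simp)] at hc
        rw [IsCentralPair]
        omega
      · intro h
        have hsub : (Finset.univ.filter fun l' => dist (x j) (x l') ≤ dist (x j) (x l)) ⊆
            Finset.univ.filter fun l' => dist (x j) (x l') ≤ r :=
          Finset.monotone_filter_right _ fun l' _ h' => h'.trans h
        have hc := Finset.card_le_card hsub
        have he := Finset.pred_card_le_card_erase (a := j)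
          (s := Finset.univ.filter fun l' => dist (x j) (x l') ≤ r)
        rw [IsCentralPair] at hlC
        omega
    rw [medianDist, hset, csInf_Ici]
  -- For a single point every real r qualifies, and the infimum of all reals is 0 by convention, as
  -- is the distance from the point to itself.
  · have : Subsingleton (Fin k) := Fin.subsingleton_iff_le_one.2 hk
    rw [Subsingleton.elim l j, medianDist, dist_self]
    have h0 : k - 1 = 0 := by omega
    simp [h0]

/-- The program searches all pairs for a shortest central pair; its first entry is a median. -/
theorem isMedianPoint_of_isCentralPair {x : Fin k → E d} {j l : Fin k} (h : IsCentralPair x j l)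
    (hmin : ∀ j' l', IsCentralPair x j' l' → dist (x j) (x l) ≤ dist (x j') (x l')) :
    IsMedianPoint x j := fun j' => by
  obtain ⟨⟨l', hl', he⟩, -⟩ := isLeast_medianDist x j'
  rw [he]
  exact ((isLeast_medianDist x j).2 ⟨l, h, rfl⟩).trans (hmin j' l' hl')

theorem exists_minimal_isCentralPair (hk : 0 < k) (x : Fin k → E d) :
    ∃ j l, IsCentralPair x j l ∧
      ∀ j' l', IsCentralPair x j' l' → dist (x j) (x l) ≤ dist (x j') (x l') := by
  classical
  set T := Finset.univ.filter fun p : Fin k × Fin k => IsCentralPair x p.1 p.2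
  have hT : T.Nonempty := by
    obtain ⟨⟨l, hl, -⟩, -⟩ := isLeast_medianDist x ⟨0, hk⟩
    exact ⟨(⟨0, hk⟩, l), Finset.mem_filter.2 ⟨Finset.mem_univ _, hl⟩⟩
  obtain ⟨p, hp, hmin⟩ := Finset.exists_min_image T (fun p => dist (x p.1) (x p.2)) hT
  exact ⟨p.1, p.2, (Finset.mem_filter.1 hp).2, fun j' l' h =>
    hmin (j', l') (Finset.mem_filter.2 ⟨Finset.mem_univ _, h⟩)⟩

-- Points within ρ of z are within 2ρ of each other, so their median distances, and hence the
-- smallest one, are at most 2ρ. The ball of that radius about the median contains more than half of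
-- the points and meets the majority near z, giving 2ρ + ρ.
open Classical in
theorem IsMedianPoint.norm_sub_le {x : Fin k → E d} {j : Fin k} (hj : IsMedianPoint x j) {z : E d}
    {ρ : ℝ} (hmaj : k < 2 * (Finset.univ.filter fun l => ‖z - x l‖ ≤ ρ).card) :
    ‖z - x j‖ ≤ 3 * ρ := by
  set G := Finset.univ.filter fun l => ‖z - x l‖ ≤ ρ
  have hG : G.Nonempty := by
    rw [← Finset.card_pos]
    omega
  have hdist : ∀ l ∈ G, ∀ l' ∈ G, dist (x l) (x l') ≤ 2 * ρ := fun l hl l' hl' => by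
    have h1 : dist (x l) z ≤ ρ := by rw [dist_comm, dist_eq_norm]; exact (Finset.mem_filter.1 hl).2
    have h2 : dist z (x l') ≤ ρ := by rw [dist_eq_norm]; exact (Finset.mem_filter.1 hl').2
    linarith [dist_triangle (x l) z (x l')]
  obtain ⟨g, hg⟩ := hG
  obtain ⟨l, hl, hmax⟩ := Finset.exists_max_image G (fun l => dist (x g) (x l)) ⟨g, hg⟩
  have hgl : IsCentralPair x g l := by
    have hsub : G ⊆ Finset.univ.filter fun l' => dist (x g) (x l') ≤ dist (x g) (x l) :=
      fun l' hl' => Finset.mem_filter.2 ⟨Finset.mem_univ _, hmax l' hl'⟩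
    have := Finset.card_le_card hsub
    rw [IsCentralPair]
    omega
  have hjr : medianDist x j ≤ 2 * ρ :=
    (hj g).trans (((isLeast_medianDist x g).2 ⟨l, hgl, rfl⟩).trans (hdist g hg l hl))
  obtain ⟨⟨l', hl', he⟩, -⟩ := isLeast_medianDist x j
  rw [he] at hjr
  rw [IsCentralPair] at hl'
  -- Two sets of more than half of the k indices must intersect.
  have hinter : ((Finset.univ.filter fun l'' => dist (x j) (x l'') ≤ dist (x j) (x l')) ∩
      G).Nonempty := by
    rw [← Finset.card_pos]
    have h1 := Finset.card_union_add_card_inter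
      (Finset.univ.filter fun l'' => dist (x j) (x l'') ≤ dist (x j) (x l')) G
    have h2 := Finset.card_le_univ
      ((Finset.univ.filter fun l'' => dist (x j) (x l'') ≤ dist (x j) (x l')) ∪ G)
    rw [Fintype.card_fin] at h2
    omega
  obtain ⟨m, hm⟩ := hinter
  rw [Finset.mem_inter] at hm
  have h1 : dist (x j) (x m) ≤ 2 * ρ := (Finset.mem_filter.1 hm.1).2.trans hjr
  have h2 : dist z (x m) ≤ ρ := by rw [dist_eq_norm]; exact (Finset.mem_filter.1 hm.2).2
  rw [← dist_eq_norm]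
  linarith [dist_triangle_right z (x j) (x m)]

end Median

-- Union bound over the at most 2^k index sets S with 2|S| ≥ k: all events in S occur with
-- probability at most 16^(-|S|) ≤ 4^(-k).
open Classical in
theorem measure_half_of_iIndepFun_mem_le {Ω β : Type*} [MeasurableSpace Ω] [MeasurableSpace β]
    {P : Measure Ω} {k : ℕ} {X : Fin k → Ω → β} (hX : iIndepFun X P) {B : Set β}
    (hB : MeasurableSet B) (hp : ∀ j, P (X j ⁻¹' B) ≤ 1 / 16) :
    P {ω | k ≤ 2 * (Finset.univ.filter fun j => X j ω ∈ B).card} ≤ (1 / 2) ^ k := by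
  set 𝒮 := (Finset.univ : Finset (Finset (Fin k))).filter fun S => k ≤ 2 * S.card
  have hsub : {ω | k ≤ 2 * (Finset.univ.filter fun j => X j ω ∈ B).card} ⊆
      ⋃ S ∈ 𝒮, ⋂ j ∈ S, X j ⁻¹' B := fun ω hω => by
    refine Set.mem_iUnion₂.2 ⟨Finset.univ.filter fun j => X j ω ∈ B,
      Finset.mem_filter.2 ⟨Finset.mem_univ _, hω⟩, ?_⟩
    simp
  have hS : ∀ S ∈ 𝒮, P (⋂ j ∈ S, X j ⁻¹' B) ≤ (1 / 4) ^ k := fun S hS => by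
    rw [hX.measure_inter_preimage_eq_mul S fun _ _ => hB]
    calc ∏ j ∈ S, P (X j ⁻¹' B) ≤ ∏ _j ∈ S, (1 / 16 : ENNReal) :=
          Finset.prod_le_prod' fun j _ => hp j
      _ = (1 / 4) ^ (2 * S.card) := by
          rw [Finset.prod_const, pow_mul]
          congr 1
          rw [one_div, one_div, ← ENNReal.inv_pow]
          norm_num
      _ ≤ (1 / 4) ^ k :=
          pow_le_pow_right_of_le_one' (by
            rw [one_div]
            exact ENNReal.inv_le_one.2 (by norm_num)) (Finset.mem_filter.1 hS).2
  calc _ ≤ P (⋃ S ∈ 𝒮, ⋂ j ∈ S, X j ⁻¹' B) := measure_mono hsub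
    _ ≤ ∑ S ∈ 𝒮, P (⋂ j ∈ S, X j ⁻¹' B) := measure_biUnion_finset_le _ _
    _ ≤ ∑ _S ∈ 𝒮, (1 / 4) ^ k := Finset.sum_le_sum hS
    _ ≤ ∑ _S : Finset (Fin k), (1 / 4) ^ k :=
        Finset.sum_le_sum_of_subset (Finset.filter_subset _ _)
    _ = (1 / 2) ^ k := by
        rw [Finset.sum_const, Finset.card_univ, Fintype.card_finset, Fintype.card_fin,
          nsmul_eq_mul]
        push_cast
        rw [← mul_pow]
        congr 1
        rw [one_div, one_div, show (4 : ENNReal) = 2 * 2 by norm_num,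
          ENNReal.mul_inv (by simp) (by simp), ← mul_assoc, ENNReal.mul_inv_cancel (by simp)
          (by simp), one_mul]

/-! ### Polynomial bounds -/

/-- The function is bounded by a polynomial. -/
def PolyBounded (f : ℕ → ℕ) : Prop := ∃ C K : ℕ, ∀ N, 1 ≤ N → f N ≤ C * N ^ K

namespace PolyBounded

theorem const (c : ℕ) : PolyBounded fun _ => c := ⟨c, 0, fun N _ => by simp⟩

theorem id : PolyBounded fun N => N := ⟨1, 1, fun N _ => by simp⟩

theorem add {f g : ℕ → ℕ} (hf : PolyBounded f) (hg : PolyBounded g) :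
    PolyBounded fun N => f N + g N := by
  obtain ⟨C, K, h⟩ := hf
  obtain ⟨C', K', h'⟩ := hg
  refine ⟨C + C', K + K', fun N hN => (add_le_add (h N hN) (h' N hN)).trans ?_⟩
  rw [add_mul]
  have h1 : N ^ K ≤ N ^ (K + K') := Nat.pow_le_pow_right hN (by omega)
  have h2 : N ^ K' ≤ N ^ (K + K') := Nat.pow_le_pow_right hN (by omega)
  gcongr

theorem mul {f g : ℕ → ℕ} (hf : PolyBounded f) (hg : PolyBounded g) :
    PolyBounded fun N => f N * g N := by
  obtain ⟨C, K, h⟩ := hf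
  obtain ⟨C', K', h'⟩ := hg
  refine ⟨C * C', K + K', fun N hN => (Nat.mul_le_mul (h N hN) (h' N hN)).trans (le_of_eq ?_)⟩
  ring

/-- The variable of a finite sum may exceed the register bound N by a constant factor, which is
absorbed here. -/
theorem comp_const_mul {f : ℕ → ℕ} (hf : PolyBounded f) {c : ℕ} (hc : 1 ≤ c) :
    PolyBounded fun N => f (c * N) := by
  obtain ⟨C, K, h⟩ := hf
  refine ⟨C * c ^ K, K, fun N hN => (h _ (Nat.mul_pos hc hN)).trans (le_of_eq ?_)⟩
  ring

end PolyBounded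

/-! ### Values of index expressions and costs of real expressions -/

namespace RealRAM

theorem IExpr.exists_eval_le (e : IExpr) :
    ∃ c, 1 ≤ c ∧ ∀ (N : ℕ) (σ : ℕ → ℕ), 1 ≤ N → (∀ x, σ x ≤ N) → e.eval σ ≤ c * N := by
  induction e with
  | const n =>
    refine ⟨n + 1, by omega, fun N σ hN _ => ?_⟩
    have := Nat.mul_le_mul_left (n + 1) hN
    simp only [IExpr.eval]
    omega
  | var x => exact ⟨1, le_rfl, fun N σ _ h => by simpa [IExpr.eval] using h x⟩
  | add e f ihe ihf =>
    obtain ⟨c, hc, h⟩ := ihe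
    obtain ⟨c', _, h'⟩ := ihf
    refine ⟨c + c', by omega, fun N σ hN hσ => ?_⟩
    rw [add_mul]
    exact add_le_add (h N σ hN hσ) (h' N σ hN hσ)

/-- Only sums cost more than a constant. Index expressions grow linearly in the registers, and the
nesting depth is fixed by the expression, so the bound stays polynomial. -/
theorem RExpr.exists_cost_le (e : RExpr) :
    ∃ f, PolyBounded f ∧ ∀ (N : ℕ) (σ : ℕ → ℕ), 1 ≤ N → (∀ x, σ x ≤ N) → e.cost σ ≤ f N := by
  induction e with
  | const q => exact ⟨_, .const 1, fun N σ _ _ => le_rfl⟩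
  | ofIndex i => exact ⟨_, .const (i.cost + 1), fun N σ _ _ => le_rfl⟩
  | get A i j => exact ⟨_, .const (i.cost + j.cost + 1), fun N σ _ _ => le_rfl⟩
  | coord i => exact ⟨_, .const (i.cost + 1), fun N σ _ _ => le_rfl⟩
  | add e f ihe ihf | sub e f ihe ihf | mul e f ihe ihf | div e f ihe ihf | max e f ihe ihf
  | min e f ihe ihf | le e f ihe ihf =>
    obtain ⟨g, hg, h⟩ := ihe
    obtain ⟨g', hg', h'⟩ := ihf
    exact ⟨_, (hg.add hg').add (.const 1), fun N σ hN hσ =>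
      Nat.add_le_add_right (add_le_add (h N σ hN hσ) (h' N σ hN hσ)) 1⟩
  | sqrt e ih =>
    obtain ⟨g, hg, h⟩ := ih
    exact ⟨_, hg.add (.const 1), fun N σ hN hσ => Nat.add_le_add_right (h N σ hN hσ) 1⟩
  | sum x n e ih =>
    obtain ⟨g, hg, h⟩ := ih
    obtain ⟨c, hc, hn⟩ := n.exists_eval_le
    refine ⟨_, (((PolyBounded.const n.cost).add (((PolyBounded.const c).mul .id).mul
      ((hg.comp_const_mul hc).add (.const 1)))).add (.const 1)), fun N σ hN hσ => ?_⟩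
    have hcN : N ≤ c * N := Nat.le_mul_of_pos_left N hc
    simp only [RExpr.cost]
    refine Nat.add_le_add_right (Nat.add_le_add_left ?_ _) 1
    calc _ ≤ ∑ _l ∈ Finset.range (n.eval σ), (g (c * N) + 1) := by
          refine Finset.sum_le_sum fun l hl => Nat.add_le_add_right
            (h _ _ (hN.trans hcN) fun z => ?_) 1
          have := hn N σ hN hσ
          rw [Finset.mem_range] at hl
          rw [Function.update_apply]
          split_ifs
          · omega
          · exact (hσ z).trans hcN
      _ ≤ c * N * (g (c * N) + 1) := by
          rw [Finset.sum_const, Finset.card_range, smul_eq_mul]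
          exact Nat.mul_le_mul_right _ (hn N σ hN hσ)

/-! ### Programs with bounded loops -/

/-- Programs in which all loops are `for` loops with a counter. -/
inductive LCom : Type
  | set (A : ℕ) (i j : IExpr) (e : RExpr)
  | sample (A : ℕ) (i j : IExpr)
  | query (A : ℕ) (i j : IExpr) (e : RExpr)
  | copyIndex (x y : ℕ)
  | seq (p q : LCom)
  | ite (e f : RExpr) (p : LCom)
  | forLoop (x y : ℕ) (p : LCom)

namespace LCom

/-- The program as a machine program. -/
def compile : LCom → Com
  | set A i j e => .set A i j e
  | sample A i j => .sample A i j
  | query A i j e => .query A i j e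
  | copyIndex x y => .setIndex x (.var y)
  | seq p q => .seq p.compile q.compile
  | ite e f p => .ite e f p.compile .skip
  | forLoop x y p => .seq (.setIndex x (.const 0))
      (.loop (.ofIndex (.var x)) (.ofIndex (.var y))
        (.seq p.compile (.setIndex x (.add (.var x) (.const 1)))))

/-- The program does not write to the index register `z`. -/
def Preserves (z : ℕ) : LCom → Prop
  | set _ _ _ _ => True
  | sample _ _ _ => True
  | query _ _ _ _ => True
  | copyIndex x _ => x ≠ z
  | seq p q => p.Preserves z ∧ q.Preserves z
  | ite _ _ p => p.Preserves z
  | forLoop x _ p => x ≠ z ∧ p.Preserves z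

/-- The bodies of loops write neither to the counter nor to the bound. -/
def WellFormed : LCom → Prop
  | set _ _ _ _ => True
  | sample _ _ _ => True
  | query _ _ _ _ => True
  | copyIndex _ _ => True
  | seq p q => p.WellFormed ∧ q.WellFormed
  | ite _ _ p => p.WellFormed
  | forLoop x y p => x ≠ y ∧ p.Preserves x ∧ p.Preserves y ∧ p.WellFormed

end LCom

variable {d : ℕ}

/-- Write the number `n` to the index register `x`. -/
def State.setIdx (s : State d) (x n : ℕ) : State d := { s with idx := Function.update s.idx x n }

/-- The state after `n` iterations of a `for` loop with counter `x`. -/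
def forState (body : State d → State d) (x : ℕ) (s : State d) : ℕ → State d
  | 0 => s.setIdx x 0
  | n + 1 => (body (forState body x s n)).setIdx x (n + 1)

theorem forState_idx (body : State d → State d) (x : ℕ) (s : State d) (n : ℕ) :
    (forState body x s n).idx x = n := by
  cases n <;> simp [forState, State.setIdx]

/-- The loop invariant rule; the current value of the counter is available when the body is
analysed. -/
theorem forState_induction {body : State d → State d} {x : ℕ} {s : State d}
    {I : ℕ → State d → Prop} (n : ℕ) (h0 : I 0 (s.setIdx x 0))
    (hs : ∀ i < n, ∀ s', s'.idx x = i → I i s' → I (i + 1) ((body s').setIdx x (i + 1))) :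
    I n (forState body x s n) := by
  have : ∀ i ≤ n, I i (forState body x s i) := fun i => by
    induction i with
    | zero => exact fun _ => h0
    | succ i ih => exact fun hi => hs i hi _ (forState_idx ..) (ih (by omega))
  exact this n le_rfl

theorem State.setIdx_idx_le {N : ℕ} {s : State d} (hs : ∀ x, s.idx x ≤ N) {x n : ℕ}
    (hn : n ≤ N) (z : ℕ) : (s.setIdx x n).idx z ≤ N := by
  simp only [State.setIdx, Function.update_apply]
  split_ifs
  · exact hn
  · exact hs z

theorem forState_idx_le {N : ℕ} {body : State d → State d}
    (hb : ∀ s : State d, (∀ z, s.idx z ≤ N) → ∀ z, (body s).idx z ≤ N) {s : State d}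
    (hs : ∀ z, s.idx z ≤ N) {x n : ℕ} (hn : n ≤ N) (z : ℕ) : (forState body x s n).idx z ≤ N :=
  forState_induction (I := fun _ s => ∀ z, s.idx z ≤ N) n (State.setIdx_idx_le hs (Nat.zero_le _))
    (fun _ hi s' _ h => State.setIdx_idx_le (hb s' h) ((Nat.succ_le_of_lt hi).trans hn)) z

open Classical in
/-- The state in which the program halts. -/
noncomputable def LCom.run (O : Oracle d) (ω : ℕ → ℝ) : LCom → State d → State d
  | .set A i j e, s => s.write A i j (s.val e)
  | .sample A i j, s => { s.write A i j (ω s.coins) with coins := s.coins + 1 }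
  | .query A i j e, s => { s.write A i j (O s.hist (s.queryFun e)) with
      hist := s.hist ++ [(s.queryFun e, O s.hist (s.queryFun e))] }
  | .copyIndex x y, s => s.setIdx x (s.idx y)
  | .seq p q, s => q.run O ω (p.run O ω s)
  | .ite e f p, s => if s.val e < s.val f then p.run O ω s else s
  | .forLoop x y p, s => forState (p.run O ω) x s (s.idx y)

theorem LCom.run_idx_of_preserves {O : Oracle d} {ω : ℕ → ℝ} {z : ℕ} (p : LCom)
    (hp : p.Preserves z) (s : State d) : (p.run O ω s).idx z = s.idx z := by
  induction p generalizing s with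
  | set | sample | query => rfl
  | copyIndex x y => simp [LCom.run, State.setIdx, Function.update_of_ne (Ne.symm hp)]
  | seq p q ihp ihq => rw [LCom.run, ihq hp.2, ihp hp.1]
  | ite e f p ih =>
    rw [LCom.run]
    split_ifs
    · exact ih hp s
    · rfl
  | forLoop x y p ih =>
    rw [LCom.run]
    generalize s.idx y = n
    induction n with
    | zero => simp [forState, State.setIdx, Function.update_of_ne hp.1.symm]
    | succ n ihn =>
      rw [forState, State.setIdx]
      simp only [Function.update_of_ne hp.1.symm]
      rw [ih hp.2, ihn]

/-- Registers change only by copying or by counting up to another register, so one bound on the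
initial registers serves the whole run. -/
theorem LCom.run_idx_le {O : Oracle d} {ω : ℕ → ℝ} {N : ℕ} (p : LCom) (s : State d)
    (hs : ∀ x, s.idx x ≤ N) (z : ℕ) : (p.run O ω s).idx z ≤ N := by
  induction p generalizing s z with
  | set | sample | query => exact hs z
  | copyIndex x y => exact State.setIdx_idx_le hs (hs y) z
  | seq p q ihp ihq => exact ihq _ (ihp s hs) z
  | ite e f p ih =>
    rw [LCom.run]
    split_ifs
    · exact ih s hs z
    · exact hs z
  | forLoop x y p ih =>
    exact forState_idx_le ih hs (hs y) z

/-- Since N bounds all registers throughout, each loop has at most N iterations. The bound depends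
on the program alone, uniformly in the dimension, the oracle and the coins. -/
theorem LCom.exists_exec (p : LCom) (hp : p.WellFormed) :
    ∃ f, PolyBounded f ∧ ∀ {d : ℕ} (O : Oracle d) (ω : ℕ → ℝ) (N : ℕ) (s : State d), 1 ≤ N →
      (∀ x, s.idx x ≤ N) → ∃ t ≤ f N, Exec O ω p.compile s (p.run O ω s) t := by
  induction p with
  | set A i j e =>
    obtain ⟨g, hg, h⟩ := e.exists_cost_le
    exact ⟨_, ((PolyBounded.const (i.cost + j.cost)).add hg).add (.const 1),
      fun O ω N s hN hs => ⟨_, Nat.add_le_add_right (Nat.add_le_add_left (h N _ hN hs) _) 1,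
        Exec.set s A i j e⟩⟩
  | sample A i j =>
    exact ⟨_, .const (i.cost + j.cost + 1), fun O ω N s hN hs => ⟨_, le_rfl,
      Exec.sample s A i j⟩⟩
  | query A i j e =>
    obtain ⟨g, hg, h⟩ := e.exists_cost_le
    exact ⟨_, ((PolyBounded.const (i.cost + j.cost)).add hg).add (.const 1),
      fun O ω N s hN hs => ⟨_, Nat.add_le_add_right (Nat.add_le_add_left (h N _ hN hs) _) 1,
        Exec.query s A i j e⟩⟩
  | copyIndex x y =>
    exact ⟨_, .const 2, fun O ω N s hN hs => ⟨_, le_rfl, Exec.setIndex s x (.var y)⟩⟩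
  | seq p q ihp ihq =>
    obtain ⟨g, hg, h⟩ := ihp hp.1
    obtain ⟨g', hg', h'⟩ := ihq hp.2
    refine ⟨_, hg.add hg', fun O ω N s hN hs => ?_⟩
    obtain ⟨t, ht, he⟩ := h O ω N s hN hs
    obtain ⟨t', ht', he'⟩ := h' O ω N _ hN (p.run_idx_le s hs)
    exact ⟨_, add_le_add ht ht', Exec.seq _ _ _ _ _ _ _ he he'⟩
  | ite e f p ih =>
    obtain ⟨g, hg, h⟩ := ih hp
    obtain ⟨ce, hce, he⟩ := e.exists_cost_le
    obtain ⟨cf, hcf, hf⟩ := f.exists_cost_le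
    refine ⟨_, ((hce.add hcf).add (.const 1)).add (hg.add (.const 1)), fun O ω N s hN hs => ?_⟩
    have h1 := he N _ hN hs
    have h2 := hf N _ hN hs
    obtain ⟨t, ht, hx⟩ := h O ω N s hN hs
    simp only [LCom.run]
    split_ifs with hlt
    · exact ⟨_, by omega, Exec.iteTrue _ _ _ _ _ _ _ hlt hx⟩
    · exact ⟨_, by omega, Exec.iteFalse _ _ _ _ _ _ _ hlt (Exec.skip s)⟩
  | forLoop x y p ih =>
    obtain ⟨hxy, hx, hy, hwf⟩ := hp
    obtain ⟨g, hg, h⟩ := ih hwf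
    refine ⟨_, (PolyBounded.const 2).add ((PolyBounded.id.mul (hg.add (.const 9))).add (.const 5)),
      fun O ω N s hN hs => ?_⟩
    set n := s.idx y
    set S := forState (p.run O ω) x s
    have hSx : ∀ i, (S i).idx x = i := forState_idx _ _ _
    have hSy : ∀ i, (S i).idx y = n := fun i => by
      induction i with
      | zero => simp [S, forState, State.setIdx, Function.update_of_ne hxy.symm, n]
      | succ i ihi =>
        simp only [S, forState, State.setIdx, Function.update_of_ne hxy.symm]
        rw [p.run_idx_of_preserves hy]
        exact ihi
    have hSN : ∀ i ≤ n, ∀ z, (S i).idx z ≤ N := fun i hi =>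
      forState_idx_le (p.run_idx_le (O := O) (ω := ω)) hs (hi.trans (hs y))
    -- Induction on the number m of remaining iterations. Besides the body, an iteration costs 5 for
    -- the test and 4 for the increment; the last, failing test costs 5.
    have hloop : ∀ m i, i + m = n → ∃ t ≤ m * (g N + 9) + 5, Exec O ω
        (.loop (.ofIndex (.var x)) (.ofIndex (.var y))
          (.seq p.compile (.setIndex x (.add (.var x) (.const 1))))) (S i) (S n) t := by
      intro m
      induction m with
      | zero =>
        rintro i rfl
        refine ⟨_, ?_, Exec.loopFalse _ _ _ _ ?_⟩
        · simp [RExpr.cost, IExpr.cost]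
        · simp [State.val, RExpr.eval, IExpr.eval, hSx, hSy]
      | succ m ihm =>
        intro i hi
        obtain ⟨t, ht, he⟩ := ihm (i + 1) (by omega)
        obtain ⟨t', ht', he'⟩ := h O ω N (S i) hN (hSN i (by omega))
        have hstep : Exec O ω (.setIndex x (.add (.var x) (.const 1))) (p.run O ω (S i))
            (S (i + 1)) 4 := by
          have h1 := Exec.setIndex (O := O) (ω := ω) (p.run O ω (S i)) x
            (.add (.var x) (.const 1))
          have h2 : (p.run O ω (S i)).idx x = i := by rw [p.run_idx_of_preserves hx, hSx]
          simp only [IExpr.eval, h2] at h1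
          exact h1
        refine ⟨_, ?_, Exec.loopTrue _ _ _ _ _ _ _ _ ?_
          (Exec.seq _ _ _ _ _ _ _ he' hstep) he⟩
        · simp only [RExpr.cost, IExpr.cost]
          rw [add_mul]
          omega
        · simp only [State.val, RExpr.eval, IExpr.eval, hSx, hSy, Nat.cast_lt]
          omega
    obtain ⟨t, ht, he⟩ := hloop n 0 (by omega)
    refine ⟨_, ?_, Exec.seq _ _ _ _ _ _ _ (Exec.setIndex s x (.const 0)) he⟩
    have : n * (g N + 9) ≤ N * (g N + 9) := Nat.mul_le_mul_right _ (hs y)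
    simp only [IExpr.cost]
    omega

/-! ### Loops that fill the row of an array -/

/-- Overwrite the first `n` entries of a row. -/
def fillRow (arr : ℕ → ℕ → ℕ → ℝ) (A r n : ℕ) (v : ℕ → ℝ) (B i j : ℕ) : ℝ :=
  if B = A ∧ i = r ∧ j < n then v j else arr B i j

theorem fillRow_zero (arr : ℕ → ℕ → ℕ → ℝ) (A r : ℕ) (v : ℕ → ℝ) : fillRow arr A r 0 v = arr := by
  funext B i j
  simp [fillRow]

theorem fillRow_succ (arr : ℕ → ℕ → ℕ → ℝ) (A r n : ℕ) (v : ℕ → ℝ) :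
    Function.update (fillRow arr A r n v) A (Function.update (fillRow arr A r n v A) r
      (Function.update (fillRow arr A r n v A r) n (v n))) = fillRow arr A r (n + 1) v := by
  funext B i j
  by_cases hB : B = A
  · subst hB
    by_cases hi : i = r
    · subst hi
      by_cases hj : j = n
      · subst hj
        simp [fillRow]
      · have : j < n ↔ j < n + 1 := by omega
        simp [fillRow, Function.update_of_ne hj, this]
    · simp [fillRow, hi]
  · simp [fillRow, hB]

theorem fillRow_of_ne {arr : ℕ → ℕ → ℕ → ℝ} {A r n : ℕ} {v : ℕ → ℝ} {B : ℕ} (h : B ≠ A)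
    (i j : ℕ) : fillRow arr A r n v B i j = arr B i j := by
  simp [fillRow, h]

theorem fillRow_of_row_ne {arr : ℕ → ℕ → ℕ → ℝ} {A r n : ℕ} {v : ℕ → ℝ} {i : ℕ} (h : i ≠ r)
    (B j : ℕ) : fillRow arr A r n v B i j = arr B i j := by
  simp [fillRow, h]

theorem fillRow_self {arr : ℕ → ℕ → ℕ → ℝ} {A r n : ℕ} {v : ℕ → ℝ} {j : ℕ} (h : j < n) :
    fillRow arr A r n v A r j = v j := by
  simp [fillRow, h]

/-- The entry is evaluated on the partially filled row, because Gram-Schmidt reads earlier rows of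
the array it is writing to. -/
theorem run_forLoop_set {O : Oracle d} {ω : ℕ → ℝ} {A x y : ℕ} {i : IExpr} {e : RExpr}
    {s : State d} (r : ℕ) (v : ℕ → ℝ)
    (hi : ∀ l, i.eval (Function.update s.idx x l) = r)
    (he : ∀ l < s.idx y, e.eval (fillRow s.arr A r l v) (0 : E d) (Function.update s.idx x l) =
      v l) :
    LCom.run O ω (.forLoop x y (.set A i (.var x) e)) s =
      { s with idx := Function.update s.idx x (s.idx y), arr := fillRow s.arr A r (s.idx y) v } := by
  refine forState_induction (I := fun n s' => s' = { s with
    idx := Function.update s.idx x n, arr := fillRow s.arr A r n v }) (s.idx y) ?_ ?_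
  · simp [State.setIdx, fillRow_zero]
  · rintro l hl _ - rfl
    simp only [LCom.run, State.setIdx, State.write, State.val, hi, he l hl, IExpr.eval,
      Function.update_self, Function.update_idem, fillRow_succ]

theorem run_forLoop_sample {O : Oracle d} {ω : ℕ → ℝ} {A x y : ℕ} {i : IExpr}
    {s : State d} (r : ℕ) (hi : ∀ l, i.eval (Function.update s.idx x l) = r) :
    LCom.run O ω (.forLoop x y (.sample A i (.var x))) s =
      { s with
        idx := Function.update s.idx x (s.idx y)
        arr := fillRow s.arr A r (s.idx y) fun l => ω (s.coins + l)
        coins := s.coins + s.idx y } := by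
  refine forState_induction (I := fun n s' => s' = { s with
    idx := Function.update s.idx x n
    arr := fillRow s.arr A r n fun l => ω (s.coins + l)
    coins := s.coins + n }) (s.idx y) ?_ ?_
  · simp [State.setIdx, fillRow_zero]
  · rintro l hl _ - rfl
    have := fillRow_succ s.arr A r l fun l => ω (s.coins + l)
    simp only [LCom.run, State.setIdx, State.write, hi, IExpr.eval,
      Function.update_self, Function.update_idem, this, Nat.add_assoc]

end RealRAM

namespace RealRAM

/-! ### The program -/

/-- An entry of the next vector of the Gram-Schmidt process (vector number `4`, coordinate in
register `x`); the normalized vectors are in array `5`, the input vector is in array `4`. -/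
def gsEntry (x : ℕ) : RExpr :=
  .sub (.get 4 (.const 0) (.var x))
    (.sum 6 (.var 4) (.mul
      (.sum 7 (.var 0) (.mul (.get 5 (.var 6) (.var 7)) (.get 4 (.const 0) (.var 7))))
      (.get 5 (.var 6) (.var x))))

/-- An entry of the next normalized vector of the Gram-Schmidt process. -/
def gsNormedEntry : RExpr :=
  .div (gsEntry 5) (.sqrt (.sum 8 (.var 0) (.mul (gsEntry 8) (gsEntry 8))))

/-- The truncated coordinate of the argument of a query. -/
def truncExpr : RExpr :=
  .div (.max (.sub (.const 0) (.get 3 (.const 0) (.const 0)))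
    (.min (.get 3 (.const 0) (.const 0))
      (.sum 6 (.var 0) (.mul (.get 5 (.var 4) (.var 6)) (.coord (.var 6))))))
    (.get 3 (.const 0) (.const 0))

/-- Draw a random vector, orthonormalize it and ask for the truncated coordinate. -/
def vectorProg : LCom :=
  .seq (.forLoop 5 0 (.sample 4 (.const 0) (.var 5)))
    (.seq (.forLoop 5 0 (.set 5 (.var 4) (.var 5) gsNormedEntry))
      (.query 6 (.var 3) (.var 4) truncExpr))

/-- An entry of the estimate in the present basis. -/
def estimateEntry : RExpr :=
  .sum 6 (.var 0) (.mul (.mul (.get 3 (.const 0) (.const 0)) (.get 6 (.var 3) (.var 6)))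
    (.get 5 (.var 6) (.var 5)))

/-- Compute the estimates in all bases. -/
def collectProg : LCom :=
  .forLoop 3 1 (.seq (.forLoop 4 0 vectorProg)
    (.forLoop 5 0 (.set 7 (.var 3) (.var 5) estimateEntry)))

/-- The squared distance of two estimates. -/
def sqDistExpr (x y : ℕ) : RExpr :=
  .sum 11 (.var 0) (.mul (.sub (.get 7 (.var x) (.var 11)) (.get 7 (.var y) (.var 11)))
    (.sub (.get 7 (.var x) (.var 11)) (.get 7 (.var y) (.var 11))))

/-- The number of estimates which are not farther from the first one than the second one. -/
def countExpr (x y : ℕ) : RExpr := .sum 12 (.var 1) (.le (sqDistExpr x 12) (sqDistExpr x y))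

/-- The indicator of central pairs. -/
def centralExpr (x y : ℕ) : RExpr :=
  .le (.ofIndex (.add (.var 1) (.const 1))) (.add (countExpr x y) (countExpr x y))

/-- The number of central pairs of smaller distance than the pair in the registers `3`, `6`. -/
def smallerExpr : RExpr :=
  .sum 7 (.var 1) (.sum 8 (.var 1)
    (.mul (centralExpr 7 8) (.sub (.const 1) (.le (sqDistExpr 3 6) (sqDistExpr 7 8)))))

/-- The number of central pairs of the smallest distance in which the estimate with the number in
register `3` comes first. -/
def minimalExpr : RExpr := .sum 6 (.var 1) (.mul (centralExpr 3 6) (.le smallerExpr (.const 0)))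

/-- Select a median. -/
def selectProg : LCom := .forLoop 3 1 (.ite (.const 0) minimalExpr (.copyIndex 10 3))

/-- Copy the selected estimate to the output. -/
def outputProg : LCom := .forLoop 5 0 (.set 1 (.const 0) (.var 5) (.get 7 (.var 10) (.var 5)))

/-- The program after the parameters have been computed. -/
def meanProg : LCom := .seq collectProg (.seq selectProg outputProg)

theorem meanProg_wellFormed : meanProg.WellFormed := by
  simp [meanProg, collectProg, selectProg, outputProg, vectorProg, LCom.WellFormed,
    LCom.Preserves]

/-! ### Computing the bases and the estimates -/

variable {d : ℕ}

/-- The `l`-th coordinate (zero for `l ≥ d`). -/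
noncomputable def coordN (l : ℕ) : E d →ₗ[ℝ] ℝ :=
  if h : l < d then (EuclideanSpace.proj (𝕜 := ℝ) (⟨l, h⟩ : Fin d)).toLinearMap else 0

theorem coordN_apply (l : ℕ) (x : E d) : coordN l x = if h : l < d then x ⟨l, h⟩ else 0 := by
  unfold coordN
  split_ifs <;> simp

theorem coordN_coe (l : Fin d) (x : E d) : coordN l x = x l := by
  simp [coordN_apply]

theorem inner_eq_sum_coordN (x y : E d) :
    inner ℝ x y = ∑ l ∈ Finset.range d, coordN l x * coordN l y := by
  rw [Finset.sum_range]
  simp only [coordN_coe, PiLp.inner_apply, RCLike.inner_apply, conj_trivial]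
  exact Finset.sum_congr rfl fun l _ => mul_comm _ _

theorem norm_eq_sqrt_sum_coordN (x : E d) :
    ‖x‖ = √(∑ l ∈ Finset.range d, coordN l x * coordN l x) := by
  rw [← inner_eq_sum_coordN, real_inner_self_eq_norm_sq, Real.sqrt_sq (norm_nonneg x)]

theorem ext_coordN {x y : E d} (h : ∀ l < d, coordN l x = coordN l y) : x = y := by
  ext l
  simpa [coordN_coe] using h l l.2

theorem coordN_coinRow (ω : ℕ → ℝ) (j i : ℕ) {l : ℕ} (hl : l < d) :
    coordN l (coinRow d ω j i) = ω ((j * d + i) * d + l) := by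
  simp [coordN_apply, hl, coinRow]

/-- Register x is read inside the sum over register 6 and must differ from it. It is 5 for the entry
itself and 8 in the sum that forms the norm. -/
theorem eval_gsEntry {f : ℕ → E d} {i x : ℕ} {arr : ℕ → ℕ → ℕ → ℝ} {σ : ℕ → ℕ} (w : E d)
    (h0 : σ 0 = d) (h4 : σ 4 = i) (hf : ∀ l < d, arr 4 0 l = coordN l (f i))
    (hu : ∀ i' < i, ∀ l < d,
      arr 5 i' l = coordN l (InnerProductSpace.gramSchmidtNormed ℝ f i'))
    (hx6 : x ≠ 6) (hx : σ x < d) :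
    (gsEntry x).eval arr w σ = coordN (σ x) (InnerProductSpace.gramSchmidt ℝ f i) := by
  rw [gramSchmidt_eq_sub_sum_normed, map_sub, map_sum]
  simp only [gsEntry, RExpr.eval, IExpr.eval, h4, Function.update_apply, h0]
  simp only [reduceIte, Nat.reduceEqDiff, hx6, OfNat.zero_ne_ofNat]
  rw [hf _ hx]
  congr 1
  refine Finset.sum_congr rfl fun i' hi' => ?_
  have hi := Finset.mem_range.1 hi'
  rw [map_smul, inner_eq_sum_coordN, hu i' hi _ hx, smul_eq_mul]
  congr 1
  refine Finset.sum_congr rfl fun l hl => ?_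
  rw [hu i' hi l (Finset.mem_range.1 hl), hf l (Finset.mem_range.1 hl)]

theorem eval_gsNormedEntry {f : ℕ → E d} {i : ℕ} {arr : ℕ → ℕ → ℕ → ℝ} {σ : ℕ → ℕ} (w : E d)
    (h0 : σ 0 = d) (h4 : σ 4 = i) (hf : ∀ l < d, arr 4 0 l = coordN l (f i))
    (hu : ∀ i' < i, ∀ l < d,
      arr 5 i' l = coordN l (InnerProductSpace.gramSchmidtNormed ℝ f i'))
    (h5 : σ 5 < d) :
    gsNormedEntry.eval arr w σ =
      coordN (σ 5) (InnerProductSpace.gramSchmidtNormed ℝ f i) := by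
  rw [InnerProductSpace.gramSchmidtNormed, map_smul, norm_eq_sqrt_sum_coordN]
  simp only [gsNormedEntry, RExpr.eval, IExpr.eval, h0]
  rw [eval_gsEntry w h0 h4 hf hu (by norm_num) h5, smul_eq_mul, div_eq_inv_mul]
  congr 2
  simp only [RCLike.ofReal_real_eq_id, id_eq]
  congr 1
  refine Finset.sum_congr rfl fun l hl => ?_
  have := eval_gsEntry (σ := Function.update σ 8 l) (x := 8) w (by simpa using h0)
    (by simpa using h4) hf hu (by norm_num) (by simpa using hl)
  rw [this]
  simp

/-- The query for a truncated coordinate in one of the random bases. -/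
noncomputable def coinQuery (d : ℕ) (ω : ℕ → ℝ) (a : ℝ) (j i : ℕ) (w : E d) : ℝ :=
  truncate a (inner ℝ (coinBasis d ω j i) w) / a

theorem eval_truncExpr {u : E d} {a : ℝ} {arr : ℕ → ℕ → ℕ → ℝ} {σ : ℕ → ℕ} (w : E d)
    (h0 : σ 0 = d) (ha : arr 3 0 0 = a) (hu : ∀ l < d, arr 5 (σ 4) l = coordN l u) :
    truncExpr.eval arr w σ = truncate a (inner ℝ u w) / a := by
  rw [inner_eq_sum_coordN]
  simp only [truncExpr, RExpr.eval, IExpr.eval, h0, ha, truncate, Rat.cast_zero, zero_sub]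
  congr 3
  refine Finset.sum_congr rfl fun l hl => ?_
  rw [Finset.mem_range] at hl
  simp [coordN_apply, hl, hu l hl]

/-- The estimate in a basis, given the answers. -/
noncomputable def coinEstimate (d : ℕ) (ω : ℕ → ℝ) (a : ℝ) (y : ℕ → ℕ → ℝ) (j : ℕ) : E d :=
  ∑ i ∈ Finset.range d, (a * y j i) • coinBasis d ω j i

/-- The memory after `j` bases and `i` further vectors have been dealt with. -/
structure CollectInv (O : Oracle d) (ω : ℕ → ℝ) (a : ℝ) (k j i : ℕ) (s : State d) : Prop where
  idx0 : s.idx 0 = d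
  idx1 : s.idx 1 = k
  idx10 : s.idx 10 = 0
  level : s.arr 3 0 0 = a
  coins : s.coins = (j * d + i) * d
  basis : ∀ i' < i, ∀ l < d, s.arr 5 i' l = coordN l (coinBasis d ω j i')
  answers : ∀ j' i', (j' < j ∧ i' < d) ∨ (j' = j ∧ i' < i) →
    ∃ h, s.arr 6 j' i' = O h (coinQuery d ω a j' i')
  hist : s.hist = ((List.range j).flatMap fun j' =>
      (List.range d).map fun i' => (coinQuery d ω a j' i', s.arr 6 j' i')) ++
    (List.range i).map fun i' => (coinQuery d ω a j i', s.arr 6 j i')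
  estimates : ∀ j' < j, ∀ l < d, s.arr 7 j' l = coordN l (coinEstimate d ω a (s.arr 6) j')

variable {O : Oracle d} {ω : ℕ → ℝ} {a : ℝ} {k j i : ℕ} {s : State d}

theorem CollectInv.setIdx (h : CollectInv O ω a k j i s) {x : ℕ} (hx0 : x ≠ 0) (hx1 : x ≠ 1)
    (hx10 : x ≠ 10) (n : ℕ) : CollectInv O ω a k j i (s.setIdx x n) where
  idx0 := by simp [State.setIdx, Function.update_of_ne hx0.symm, h.idx0]
  idx1 := by simp [State.setIdx, Function.update_of_ne hx1.symm, h.idx1]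
  idx10 := by simp [State.setIdx, Function.update_of_ne hx10.symm, h.idx10]
  level := h.level
  coins := h.coins
  basis := h.basis
  answers := h.answers
  hist := h.hist
  estimates := h.estimates

/-- One pass consumes d coins, exactly the row with index (j, i), and then touches the arrays 4, 5
and 6 in entries that keep the earlier vectors and answers. -/
theorem CollectInv.run_vectorProg (h : CollectInv O ω a k j i s) (hi : i < d) (h3 : s.idx 3 = j)
    (h4 : s.idx 4 = i) : CollectInv O ω a k j (i + 1) (vectorProg.run O ω s) := by
  set arr₁ := fillRow s.arr 4 0 d fun l => ω (s.coins + l)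
  set s₁ : State d := { s with
    idx := Function.update s.idx 5 d, arr := arr₁, coins := s.coins + d }
  have hs₁ : LCom.run O ω (.forLoop 5 0 (.sample 4 (.const 0) (.var 5))) s = s₁ := by
    rw [run_forLoop_sample 0 fun _ => rfl, h.idx0]
  set arr₂ := fillRow arr₁ 5 i d fun l => coordN l (coinBasis d ω j i)
  set s₂ : State d := { s₁ with idx := Function.update s₁.idx 5 d, arr := arr₂ }
  have hf : ∀ l < d, arr₁ 4 0 l = coordN l (coinRow d ω j i) := fun l hl => by
    rw [coordN_coinRow _ _ _ hl, ← h.coins]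
    exact fillRow_self hl
  have hu : ∀ i' < i, ∀ l < d, arr₁ 5 i' l = coordN l (coinBasis d ω j i') := fun i' hi' l hl => by
    rw [← h.basis i' hi' l hl]
    exact fillRow_of_ne (by norm_num) _ _
  have hs₂ : LCom.run O ω (.forLoop 5 0 (.set 5 (.var 4) (.var 5) gsNormedEntry)) s₁ = s₂ := by
    have h10 : s₁.idx 0 = d := by simp [s₁, h.idx0]
    rw [run_forLoop_set i (fun l => coordN l (coinBasis d ω j i)), h10]
    · intro l
      simp [IExpr.eval, s₁, h4]
    · intro l hl
      rw [h10] at hl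
      refine (eval_gsNormedEntry (i := i) (f := coinRow d ω j) _ (by simpa using h10)
        (by simp [s₁, h4]) (fun l' hl' => ?_) (fun i' hi' l' hl' => ?_) (by simpa using hl)).trans ?_
      · rw [fillRow_of_ne (by norm_num)]
        exact hf l' hl'
      · rw [fillRow_of_row_ne (by omega)]
        exact hu i' hi' l' hl'
      · simp [coinBasis]
  have harr : ∀ B ≠ 4, B ≠ 5 → arr₂ B = s.arr B := fun B h4 h5 => by
    funext i' l
    exact (fillRow_of_ne h5 _ _).trans (fillRow_of_ne h4 _ _)
  have hq : s₂.queryFun truncExpr = coinQuery d ω a j i := by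
    funext w
    refine eval_truncExpr w (by simp [s₂, s₁, h.idx0]) ?_ fun l hl => ?_
    · rw [← h.level]
      exact congrFun (congrFun (harr 3 (by norm_num) (by norm_num)) 0) 0
    · have : s₂.idx 4 = i := by simp [s₂, s₁, h4]
      rw [this]
      exact fillRow_self (v := fun l => coordN l (coinBasis d ω j i)) hl
  have h23 : s₂.idx 3 = j := by simp [s₂, s₁, h3]
  have h24 : s₂.idx 4 = i := by simp [s₂, s₁, h4]
  have hrun : vectorProg.run O ω s = { s₂ with
      arr := Function.update arr₂ 6 (Function.update (arr₂ 6) j (Function.update (arr₂ 6 j) i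
        (O s.hist (coinQuery d ω a j i))))
      hist := s.hist ++ [(coinQuery d ω a j i, O s.hist (coinQuery d ω a j i))] } := by
    rw [vectorProg, LCom.run, hs₁, LCom.run, hs₂, LCom.run, hq]
    simp only [State.write, IExpr.eval, h23, h24]
    rfl
  rw [harr 6 (by norm_num) (by norm_num)] at hrun
  rw [hrun]
  have hY : ∀ j' i', (j' ≠ j ∨ i' ≠ i) → Function.update (s.arr 6) j (Function.update (s.arr 6 j) i
      (O s.hist (coinQuery d ω a j i))) j' i' = s.arr 6 j' i' := fun j' i' hne => by
    by_cases hj : j' = j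
    · subst hj
      simp [Function.update_of_ne (hne.resolve_left (not_not.2 rfl))]
    · simp [Function.update_of_ne hj]
  exact {
    idx0 := by simp [s₂, s₁, h.idx0]
    idx1 := by simp [s₂, s₁, h.idx1]
    idx10 := by simp [s₂, s₁, h.idx10]
    level := by
      simp only [Function.update_apply, Nat.reduceEqDiff, reduceIte]
      rw [harr 3 (by norm_num) (by norm_num), h.level]
    coins := by
      simp only [s₂, s₁, h.coins]
      ring
    basis := fun i' hi' l hl => by
      simp only [Function.update_apply, Nat.reduceEqDiff, reduceIte]
      rcases Nat.lt_succ_iff_lt_or_eq.1 hi' with hlt | rfl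
      · rw [← hu i' hlt l hl]
        exact fillRow_of_row_ne (by omega) _ _
      · exact fillRow_self hl
    -- The history behind an answer is recorded only existentially: the guarantee of the oracle is
    -- the same for all histories.
    answers := fun j' i' hji => by
      simp only [Function.update_self]
      by_cases hne : j' ≠ j ∨ i' ≠ i
      · rw [hY j' i' hne]
        exact h.answers j' i' (by omega)
      · obtain ⟨rfl, rfl⟩ : j' = j ∧ i' = i := by tauto
        exact ⟨s.hist, by simp⟩
    hist := by
      simp only [Function.update_self, h.hist]
      rw [List.range_succ, List.map_append, List.append_assoc]
      have e1 : ((List.range j).flatMap fun j' => (List.range d).map fun i' =>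
          (coinQuery d ω a j' i', Function.update (s.arr 6) j (Function.update (s.arr 6 j) i
            (O s.hist (coinQuery d ω a j i))) j' i')) =
          (List.range j).flatMap fun j' => (List.range d).map fun i' =>
            (coinQuery d ω a j' i', s.arr 6 j' i') := by
        refine List.flatMap_congr fun j' hj' => List.map_congr_left fun i' _ => ?_
        rw [hY _ _ (Or.inl (List.mem_range.1 hj').ne)]
      have e2 : ((List.range i).map fun i' => (coinQuery d ω a j i',
          Function.update (s.arr 6 j) i (O s.hist (coinQuery d ω a j i)) i')) =
          (List.range i).map fun i' => (coinQuery d ω a j i', s.arr 6 j i') := by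
        refine List.map_congr_left fun i' hi' => ?_
        rw [Function.update_of_ne (List.mem_range.1 hi').ne]
      rw [← h.hist, e1, e2]
      simp [h.hist]
    estimates := fun j' hj' l hl => by
      simp only [Function.update_apply, Nat.reduceEqDiff, reduceIte]
      rw [harr 7 (by norm_num) (by norm_num), h.estimates j' hj' l hl]
      simp [coinEstimate, hj'.ne] }

theorem CollectInv.run_basis (h : CollectInv O ω a k j 0 s) (h3 : s.idx 3 = j) :
    CollectInv O ω a k j d (LCom.run O ω (.forLoop 4 0 vectorProg) s) := by
  rw [LCom.run, h.idx0]
  have hpres : vectorProg.Preserves 3 := by simp [vectorProg, LCom.Preserves]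
  refine (forState_induction (I := fun i s => CollectInv O ω a k j i s ∧ s.idx 3 = j) d
    ⟨h.setIdx (by norm_num) (by norm_num) (by norm_num) 0, by simp [State.setIdx, h3]⟩ ?_).1
  rintro i hi s' h4 ⟨hs', h3'⟩
  refine ⟨(hs'.run_vectorProg hi h3' h4).setIdx (by norm_num) (by norm_num) (by norm_num) _, ?_⟩
  simpa [State.setIdx, LCom.run_idx_of_preserves _ hpres] using h3'

/-- Once the estimate is stored the basis may be forgotten: the counters pass from (j, d) to (j + 1,
0), which denote the same number of coins. -/
theorem CollectInv.run_estimate (h : CollectInv O ω a k j d s) (h3 : s.idx 3 = j) :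
    CollectInv O ω a k (j + 1) 0
      (LCom.run O ω (.forLoop 5 0 (.set 7 (.var 3) (.var 5) estimateEntry)) s) := by
  rw [run_forLoop_set j (fun l => coordN l (coinEstimate d ω a (s.arr 6) j)), h.idx0]
  · have harr : ∀ B ≠ 7, fillRow s.arr 7 j d
        (fun l => coordN l (coinEstimate d ω a (s.arr 6) j)) B = s.arr B := fun B hB => by
      funext i' l
      exact fillRow_of_ne hB _ _
    exact {
      idx0 := by simp [h.idx0]
      idx1 := by simp [h.idx1]
      idx10 := by simp [h.idx10]
      level := by simp only [harr 3 (by norm_num), h.level]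
      coins := by simp only [h.coins]; ring
      basis := fun i' hi' => by omega
      answers := fun j' i' hji => by
        simp only [harr 6 (by norm_num)]
        exact h.answers j' i' (by omega)
      hist := by
        simp only [harr 6 (by norm_num), h.hist, List.range_succ]
        simp
      estimates := fun j' hj' l hl => by
        simp only [harr 6 (by norm_num)]
        rcases Nat.lt_succ_iff_lt_or_eq.1 hj' with hlt | rfl
        · rw [fillRow_of_row_ne (by omega), h.estimates j' hlt l hl]
        · exact fillRow_self hl }
  · intro l
    simp [IExpr.eval, h3]
  · intro l hl
    rw [h.idx0] at hl
    simp only [estimateEntry, RExpr.eval, IExpr.eval, Function.update_apply, Nat.reduceEqDiff, reduceIte, OfNat.zero_ne_ofNat, h.idx0, h3, coinEstimate, map_sum,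
      map_smul, smul_eq_mul]
    refine Finset.sum_congr rfl fun i' hi' => ?_
    rw [fillRow_of_ne (by norm_num), fillRow_of_ne (by norm_num), fillRow_of_ne (by norm_num),
      h.level, h.basis i' (Finset.mem_range.1 hi') l hl]

theorem CollectInv.run_collectProg (h : CollectInv O ω a k 0 0 s) :
    CollectInv O ω a k k 0 (collectProg.run O ω s) := by
  rw [collectProg, LCom.run, h.idx1]
  refine forState_induction (I := fun j s => CollectInv O ω a k j 0 s) k
    (h.setIdx (by norm_num) (by norm_num) (by norm_num) 0) fun j hj s' h3 hs' => ?_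
  have hpres : (LCom.forLoop 4 0 vectorProg).Preserves 3 := by simp [vectorProg, LCom.Preserves]
  rw [LCom.run]
  refine CollectInv.setIdx ?_ (by norm_num) (by norm_num) (by norm_num) _
  exact (hs'.run_basis h3).run_estimate (by rw [LCom.run_idx_of_preserves _ hpres, h3])

end RealRAM

namespace RealRAM

/-! ### Selecting a median -/

variable {d k : ℕ} {O : Oracle d} {ω : ℕ → ℝ} {x : ℕ → E d} {arr : ℕ → ℕ → ℕ → ℝ}
  {σ : ℕ → ℕ} {w : E d}

theorem eval_sqDistExpr (h0 : σ 0 = d) (hx : ∀ j < k, ∀ l < d, arr 7 j l = coordN l (x j))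
    {p q : ℕ} (hp11 : p ≠ 11) (hq11 : q ≠ 11) (hp : σ p < k) (hq : σ q < k) :
    (sqDistExpr p q).eval arr w σ = dist (x (σ p)) (x (σ q)) ^ 2 := by
  rw [dist_eq_norm, ← real_inner_self_eq_norm_sq, inner_eq_sum_coordN]
  simp only [sqDistExpr, RExpr.eval, IExpr.eval, h0, Function.update_apply, hp11, hq11, reduceIte,
    map_sub]
  refine Finset.sum_congr rfl fun l hl => ?_
  rw [hx _ hp l (Finset.mem_range.1 hl), hx _ hq l (Finset.mem_range.1 hl)]

/-- Distances are nonnegative, so comparing squares suffices and no root is taken. -/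
theorem eval_le_sqDistExpr (h0 : σ 0 = d) (hx : ∀ j < k, ∀ l < d, arr 7 j l = coordN l (x j))
    {p q p' q' : ℕ} (hp11 : p ≠ 11) (hq11 : q ≠ 11) (hp'11 : p' ≠ 11) (hq'11 : q' ≠ 11)
    (hp : σ p < k) (hq : σ q < k) (hp' : σ p' < k) (hq' : σ q' < k)
    [Decidable (dist (x (σ p)) (x (σ q)) ≤ dist (x (σ p')) (x (σ q')))] :
    (RExpr.le (sqDistExpr p q) (sqDistExpr p' q')).eval arr w σ =
      if dist (x (σ p)) (x (σ q)) ≤ dist (x (σ p')) (x (σ q')) then 1 else 0 := by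
  rw [RExpr.eval, eval_sqDistExpr h0 hx hp11 hq11 hp hq, eval_sqDistExpr h0 hx hp'11 hq'11 hp' hq']
  simp only [sq_le_sq₀ dist_nonneg dist_nonneg]

open Classical in
theorem eval_countExpr (h0 : σ 0 = d) (h1 : σ 1 = k)
    (hx : ∀ j < k, ∀ l < d, arr 7 j l = coordN l (x j))
    {p q : ℕ} (hp11 : p ≠ 11) (hq11 : q ≠ 11) (hp12 : p ≠ 12) (hq12 : q ≠ 12)
    {j l : Fin k} (hp : σ p = j) (hq : σ q = l) :
    (countExpr p q).eval arr w σ =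
      ((Finset.univ.filter fun l' : Fin k => dist (x j) (x l') ≤ dist (x j) (x l)).card : ℝ) := by
  rw [countExpr, RExpr.eval, IExpr.eval, h1, Finset.sum_range, Finset.card_filter]
  push_cast
  refine Finset.sum_congr rfl fun l' _ => ?_
  have e : ∀ z, z ≠ 12 → Function.update σ 12 (l' : ℕ) z = σ z := fun z hz =>
    Function.update_of_ne hz _ _
  have e' : Function.update σ 12 (l' : ℕ) 12 = l' := Function.update_self ..
  rw [eval_le_sqDistExpr (k := k) (x := x) (by rw [e 0 (by norm_num), h0]) hx hp11 (by norm_num)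
    hp11 hq11 (by rw [e p hp12, hp]; exact j.2) (by rw [e']; exact l'.2)
    (by rw [e p hp12, hp]; exact j.2) (by rw [e q hq12, hq]; exact l.2)]
  simp only [e p hp12, e q hq12, e', hp, hq]

open Classical in
theorem eval_centralExpr (h0 : σ 0 = d) (h1 : σ 1 = k)
    (hx : ∀ j < k, ∀ l < d, arr 7 j l = coordN l (x j))
    {p q : ℕ} (hp11 : p ≠ 11) (hq11 : q ≠ 11) (hp12 : p ≠ 12) (hq12 : q ≠ 12)
    {j l : Fin k} (hp : σ p = j) (hq : σ q = l) :
    (centralExpr p q).eval arr w σ =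
      if IsCentralPair (fun j : Fin k => x j) j l then 1 else 0 := by
  rw [centralExpr, RExpr.eval, RExpr.eval, RExpr.eval,
    eval_countExpr h0 h1 hx hp11 hq11 hp12 hq12 hp hq]
  simp only [IExpr.eval, h1, IsCentralPair]
  congr 1
  rw [← two_mul]
  norm_cast

/-- Quantifiers become sums of indicators: a universal statement holds when the number of its
violations is zero. Dually, `minimalExpr` expresses an existential statement by a positive count. -/
theorem eval_smallerExpr_nonpos_iff (h0 : σ 0 = d) (h1 : σ 1 = k)
    (hx : ∀ j < k, ∀ l < d, arr 7 j l = coordN l (x j)) {j l : Fin k} (h3 : σ 3 = j)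
    (h6 : σ 6 = l) :
    smallerExpr.eval arr w σ ≤ 0 ↔ ∀ j' l' : Fin k, IsCentralPair (fun j : Fin k => x j) j' l' →
      dist (x j) (x l) ≤ dist (x j') (x l') := by
  classical
  have he : smallerExpr.eval arr w σ = ∑ j' : Fin k, ∑ l' : Fin k,
      if IsCentralPair (fun j : Fin k => x j) j' l' ∧
        ¬ dist (x j) (x l) ≤ dist (x j') (x l') then (1 : ℝ) else 0 := by
    -- Only the clause for sums is unfolded, so that the lemmas evaluating the summands still match.
    simp only [smallerExpr, RExpr.eval.eq_13]
    rw [IExpr.eval, h1, Finset.sum_range]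
    refine Finset.sum_congr rfl fun j' _ => ?_
    rw [IExpr.eval, Function.update_of_ne (by norm_num), h1, Finset.sum_range]
    refine Finset.sum_congr rfl fun l' _ => ?_
    set τ := Function.update (Function.update σ 7 (j' : ℕ)) 8 (l' : ℕ)
    have hτ : ∀ z, z ≠ 7 → z ≠ 8 → τ z = σ z := fun z h7 h8 => by
      simp [τ, Function.update_of_ne h7, Function.update_of_ne h8]
    have hτ7 : τ 7 = j' := by simp [τ]
    have hτ8 : τ 8 = l' := by simp [τ]
    have hτ0 : τ 0 = d := by rw [hτ 0 (by norm_num) (by norm_num), h0]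
    have hτ1 : τ 1 = k := by rw [hτ 1 (by norm_num) (by norm_num), h1]
    have hτ3 : τ 3 = j := by rw [hτ 3 (by norm_num) (by norm_num), h3]
    have hτ6 : τ 6 = l := by rw [hτ 6 (by norm_num) (by norm_num), h6]
    rw [RExpr.eval, RExpr.eval, RExpr.eval, eval_centralExpr hτ0 hτ1 hx (by norm_num)
      (by norm_num) (by norm_num) (by norm_num) hτ7 hτ8,
      eval_le_sqDistExpr hτ0 hx (by norm_num) (by norm_num) (by norm_num) (by norm_num)
        (by rw [hτ3]; exact j.2) (by rw [hτ6]; exact l.2) (by rw [hτ7]; exact j'.2)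
        (by rw [hτ8]; exact l'.2), hτ3, hτ6, hτ7, hτ8]
    by_cases hc : IsCentralPair (fun j : Fin k => x j) j' l' <;>
      by_cases hd : dist (x j) (x l) ≤ dist (x j') (x l') <;> simp [hc, hd]
  have hnn : ∀ j' l' : Fin k, (0 : ℝ) ≤ if IsCentralPair (fun j : Fin k => x j) j' l' ∧
        ¬ dist (x j) (x l) ≤ dist (x j') (x l') then (1 : ℝ) else 0 := fun j' l' => by
    split_ifs <;> norm_num
  rw [he, (Finset.sum_nonneg fun j' _ => Finset.sum_nonneg fun l' _ => hnn j' l').ge_iff_eq',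
    Finset.sum_eq_zero_iff_of_nonneg fun j' _ => Finset.sum_nonneg fun l' _ => hnn j' l']
  simp only [Finset.mem_univ, true_imp_iff]
  refine forall_congr' fun j' => ?_
  rw [Finset.sum_eq_zero_iff_of_nonneg fun l' _ => hnn j' l']
  simp only [Finset.mem_univ, true_imp_iff]
  refine forall_congr' fun l' => ?_
  simp

/-- `j` is the first entry of a central pair of the smallest distance. -/
def IsMinimalPoint (x : Fin k → E d) (j : Fin k) : Prop :=
  ∃ l, IsCentralPair x j l ∧
    ∀ j' l', IsCentralPair x j' l' → dist (x j) (x l) ≤ dist (x j') (x l')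

theorem eval_minimalExpr_pos_iff (h0 : σ 0 = d) (h1 : σ 1 = k)
    (hx : ∀ j < k, ∀ l < d, arr 7 j l = coordN l (x j)) {j : Fin k} (h3 : σ 3 = j) :
    0 < minimalExpr.eval arr w σ ↔ IsMinimalPoint (fun j : Fin k => x j) j := by
  classical
  have he : minimalExpr.eval arr w σ = ∑ l : Fin k,
      if IsCentralPair (fun j : Fin k => x j) j l ∧ ∀ j' l' : Fin k,
        IsCentralPair (fun j : Fin k => x j) j' l' →
          dist (x j) (x l) ≤ dist (x j') (x l') then (1 : ℝ) else 0 := by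
    rw [minimalExpr, RExpr.eval, IExpr.eval, h1, Finset.sum_range]
    refine Finset.sum_congr rfl fun l _ => ?_
    set τ := Function.update σ 6 (l : ℕ)
    have hτ : ∀ z, z ≠ 6 → τ z = σ z := fun z hz => Function.update_of_ne hz _ _
    have hτ6 : τ 6 = l := by simp [τ]
    have hτ0 : τ 0 = d := by rw [hτ 0 (by norm_num), h0]
    have hτ1 : τ 1 = k := by rw [hτ 1 (by norm_num), h1]
    have hτ3 : τ 3 = j := by rw [hτ 3 (by norm_num), h3]
    have hs := eval_smallerExpr_nonpos_iff (w := w) hτ0 hτ1 hx hτ3 hτ6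
    rw [RExpr.eval, eval_centralExpr hτ0 hτ1 hx (by norm_num) (by norm_num) (by norm_num)
      (by norm_num) hτ3 hτ6, RExpr.eval]
    simp only [RExpr.eval.eq_1, Rat.cast_zero, hs]
    rw [ite_and, ite_mul, one_mul, zero_mul]
  have hnn : ∀ l : Fin k, (0 : ℝ) ≤ if IsCentralPair (fun j : Fin k => x j) j l ∧
      ∀ j' l' : Fin k, IsCentralPair (fun j : Fin k => x j) j' l' →
          dist (x j) (x l) ≤ dist (x j') (x l') then (1 : ℝ) else 0 := fun l => by
    split_ifs <;> norm_num
  rw [he, Finset.sum_pos_iff_of_nonneg fun l _ => hnn l, IsMinimalPoint]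
  refine exists_congr fun l => ?_
  simp only [Finset.mem_univ, true_and]
  split_ifs with h
  · simpa using h
  · simpa using h

theorem run_selectProg {s : State d} (hk : 0 < k) (h0 : s.idx 0 = d) (h1 : s.idx 1 = k)
    (hx : ∀ j < k, ∀ l < d, s.arr 7 j l = coordN l (x j)) :
    ∃ j : Fin k, IsMinimalPoint (fun j : Fin k => x j) j ∧
      (selectProg.run O ω s).idx 10 = j ∧ (selectProg.run O ω s).idx 0 = d ∧
      (selectProg.run O ω s).arr = s.arr ∧ (selectProg.run O ω s).hist = s.hist := by
  -- Register 10 is constrained only after a minimal point has been met; its content before that is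
  -- irrelevant, since one of the k indices is minimal.
  set I : ℕ → State d → Prop := fun n s' => s'.arr = s.arr ∧ s'.hist = s.hist ∧ s'.idx 0 = d ∧
    s'.idx 1 = k ∧ ((∃ j : Fin k, (j : ℕ) < n ∧ IsMinimalPoint (fun j : Fin k => x j) j) →
      ∃ j : Fin k, IsMinimalPoint (fun j : Fin k => x j) j ∧ s'.idx 10 = j)
  have key : I k
      (forState (LCom.run O ω (.ite (.const 0) minimalExpr (.copyIndex 10 3))) 3 s k) := by
    refine forState_induction (I := I) k ⟨rfl, rfl, by simp [State.setIdx, h0],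
      by simp [State.setIdx, h1], ?_⟩ ?_
    · rintro ⟨j, hj, -⟩
      omega
    · rintro i hik s' h3 ⟨harr, hhist, h0', h1', h10⟩
      have hmin := eval_minimalExpr_pos_iff (arr := s'.arr) (w := (0 : E d)) (j := ⟨i, hik⟩)
        h0' h1' (by rw [harr]; exact hx) h3
      have hc : s'.val (.const 0) < s'.val minimalExpr ↔
          IsMinimalPoint (fun j : Fin k => x j) ⟨i, hik⟩ := by
        rw [← hmin]
        simp [State.val, RExpr.eval.eq_1]
      rw [LCom.run]
      split_ifs with hlt
      · refine ⟨harr, hhist, by simp [State.setIdx, LCom.run, h0'],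
          by simp [State.setIdx, LCom.run, h1'], fun _ => ⟨⟨i, hik⟩, hc.1 hlt, ?_⟩⟩
        simp [State.setIdx, LCom.run, h3]
      · refine ⟨harr, hhist, by simp [State.setIdx, h0'], by simp [State.setIdx, h1'], ?_⟩
        rintro ⟨j, hj, hjm⟩
        obtain ⟨j', hj', h⟩ := h10 ⟨j, lt_of_le_of_ne (by omega) (by
          rintro h
          exact hlt (hc.2 (by
            have : (⟨i, hik⟩ : Fin k) = j := Fin.ext h.symm
            rw [this]
            exact hjm))), hjm⟩
        exact ⟨j', hj', by simpa [State.setIdx] using h⟩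
  have hrun : selectProg.run O ω s =
      forState (LCom.run O ω (.ite (.const 0) minimalExpr (.copyIndex 10 3))) 3 s k := by
    rw [selectProg, LCom.run, h1]
  rw [hrun]
  obtain ⟨harr, hhist, h0', -, h10⟩ := key
  obtain ⟨j, hj⟩ := exists_minimal_isCentralPair hk fun j : Fin k => x j
  obtain ⟨j', hj', h⟩ := h10 ⟨j, j.2, hj⟩
  exact ⟨j', hj', h, h0', harr, hhist⟩

theorem run_outputProg {s : State d} {z : E d} (h0 : s.idx 0 = d)
    (hz : ∀ l < d, s.arr 7 (s.idx 10) l = coordN l z) :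
    (outputProg.run O ω s).output = z ∧ (outputProg.run O ω s).hist = s.hist := by
  rw [outputProg, run_forLoop_set 0 (fun l => coordN l z) (fun _ => rfl)]
  · refine ⟨ext_coordN fun l hl => ?_, rfl⟩
    rw [coordN_apply, dif_pos hl, State.output, h0]
    exact fillRow_self (v := fun l => coordN l z) hl
  · intro l hl
    rw [h0] at hl
    simp only [RExpr.eval, IExpr.eval, Function.update_apply, reduceIte, Nat.reduceEqDiff]
    rw [fillRow_of_ne (by norm_num), hz l hl]

theorem basisEstimate_coinBasis (a : ℝ) (y : ℕ → ℕ → ℝ) (j : ℕ) :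
    basisEstimate (fun i : Fin d => coinBasis d ω j i) a (fun i => y j i) =
      coinEstimate d ω a y j := by
  rw [basisEstimate, coinEstimate, Finset.sum_range]

theorem flatMap_range_eq_finRange {α : Type*} (f : ℕ → ℕ → α) (k d : ℕ) :
    ((List.range k).flatMap fun j => (List.range d).map fun i => f j i) =
      (List.finRange k).flatMap fun j : Fin k => (List.finRange d).map fun i : Fin d => f j i := by
  simp only [← List.map_coe_finRange_eq_range, List.flatMap_map, List.map_map]
  rfl

/-- The program asks for the truncated coordinates in the random bases and returns a median. -/
theorem CollectInv.run_meanProg {a : ℝ} {s : State d} (hk : 0 < k)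
    (h : CollectInv O ω a k 0 0 s) :
    ∃ y : Fin k → Fin d → ℝ,
      (meanProg.run O ω s).hist = (List.finRange k).flatMap (fun j : Fin k => (List.finRange d).map fun i : Fin d =>
        (truncQuery (fun i : Fin d => coinBasis d ω j i) a i, y j i)) ∧
      (∀ j i, ∃ h, y j i = O h (truncQuery (fun i : Fin d => coinBasis d ω j i) a i)) ∧
      ∃ j : Fin k,
        IsMedianPoint (fun l : Fin k =>
          basisEstimate (fun i : Fin d => coinBasis d ω l i) a (y l)) j ∧
        (meanProg.run O ω s).output =
          basisEstimate (fun i : Fin d => coinBasis d ω j i) a (y j) := by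
  have h₁ := h.run_collectProg
  rw [meanProg, LCom.run, LCom.run]
  set s₁ := collectProg.run O ω s
  obtain ⟨j, ⟨l, hjl, hmin⟩, h10, h0, harr, hhist⟩ := run_selectProg (O := O) (ω := ω) hk h₁.idx0
    h₁.idx1 (x := coinEstimate d ω a (s₁.arr 6)) h₁.estimates
  obtain ⟨hout, hhist'⟩ := run_outputProg (O := O) (ω := ω) (s := selectProg.run O ω s₁)
    (z := coinEstimate d ω a (s₁.arr 6) j) h0 (fun l hl => by
      rw [harr, h10, h₁.estimates j j.2 l hl])
  refine ⟨fun j i => s₁.arr 6 j i, ?_, fun j i => h₁.answers j i (Or.inl ⟨j.2, i.2⟩), j, ?_, ?_⟩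
  · rw [hhist', hhist, h₁.hist, List.range_zero, List.map_nil, List.append_nil]
    exact flatMap_range_eq_finRange (fun j' i' => (coinQuery d ω a j' i', s₁.arr 6 j' i')) k d
  · simp only [basisEstimate_coinBasis a (s₁.arr 6)]
    exact isMedianPoint_of_isCentralPair hjl hmin
  · rw [hout, basisEstimate_coinBasis a (s₁.arr 6)]

end RealRAM

namespace RealRAM

/-! ### Computing the parameters -/

/-- Double `A₂[0][0]` until it is at least `1`, and count the doublings in the register `x`. -/
def doublingLoop (x : ℕ) : Com :=
  .loop (.get 2 (.const 0) (.const 0)) (.const 1)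
    (.seq (.set 2 (.const 0) (.const 0)
      (.add (.get 2 (.const 0) (.const 0)) (.get 2 (.const 0) (.const 0))))
      (.setIndex x (.add (.var x) (.const 1))))

/-- Compute the number of bases in register `1` and the truncation level in `A₃[0][0]`. -/
def paramProg : Com :=
  .seq (.set 2 (.const 0) (.const 0) (.get 0 (.const 0) (.const 0)))
    (.seq (doublingLoop 2)
      (.seq (.setIndex 1 (.const 1))
        (.seq (.set 2 (.const 0) (.const 0) (.get 0 (.const 0) (.const 1)))
          (.seq (doublingLoop 1)
            (.set 3 (.const 0) (.const 0)
              (.div (.mul (.const 16) (.ofIndex (.add (.var 2) (.const 1))))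
                (.sqrt (.ofIndex (.var 0)))))))))

/-- The number of doublings that take `r` above `1`. -/
noncomputable def doublings (r : ℝ) : ℕ := sInf {m : ℕ | 1 ≤ 2 ^ m * r}

theorem one_le_two_pow_doublings_mul {r : ℝ} (hr : 0 < r) : 1 ≤ 2 ^ doublings r * r := by
  have hne : {m : ℕ | 1 ≤ 2 ^ m * r}.Nonempty := by
    obtain ⟨m, hm⟩ := pow_unbounded_of_one_lt (1 / r) (one_lt_two (α := ℝ))
    rw [div_lt_iff₀ hr] at hm
    exact ⟨m, hm.le⟩
  exact Nat.sInf_mem hne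

theorem two_pow_mul_lt_one {r : ℝ} {m : ℕ} (hm : m < doublings r) : 2 ^ m * r < 1 :=
  not_le.1 (Nat.notMem_of_lt_sInf hm)

/-- If m doublings do not suffice, then m log 2 < log(1/r), and log 2 > 1/2. This is how the machine
obtains the order of a logarithm without computing one. -/
theorem doublings_le {r : ℝ} (hr : 0 < r) : (doublings r : ℝ) ≤ 3 * max 1 (Real.log (1 / r)) := by
  have h1 : (1 : ℝ) ≤ max 1 (Real.log (1 / r)) := le_max_left _ _
  have h2 : Real.log (1 / r) ≤ max 1 (Real.log (1 / r)) := le_max_right _ _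
  rcases Nat.eq_zero_or_pos (doublings r) with h0 | hpos
  · rw [h0, Nat.cast_zero]
    linarith
  · obtain ⟨m, hm⟩ := Nat.exists_eq_succ_of_ne_zero hpos.ne'
    have hlt : 2 ^ m * r < 1 := two_pow_mul_lt_one (by omega)
    have h3 : m * Real.log 2 < Real.log (1 / r) := by
      rw [← Real.log_pow]
      exact Real.log_lt_log (by positivity) (by rwa [lt_div_iff₀ hr])
    have h4 := Real.log_two_gt_d9
    have h5 : (m : ℝ) * (1 / 2) ≤ m * Real.log 2 := by
      gcongr
      linarith
    rw [hm]
    push_cast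
    linarith

variable {d : ℕ}

/-- The memory after `m` iterations of the doubling loop. -/
noncomputable def State.doubled (s : State d) (x m : ℕ) : State d :=
  { s with
    idx := Function.update s.idx x (s.idx x + m)
    arr := fillRow s.arr 2 0 1 fun _ => 2 ^ m * s.arr 2 0 0 }

theorem State.doubled_zero (s : State d) (x : ℕ) : s.doubled x 0 = s := by
  have : fillRow s.arr 2 0 1 (fun _ => 2 ^ 0 * s.arr 2 0 0) = s.arr := by
    funext B i j
    unfold fillRow
    split_ifs with h
    · obtain ⟨rfl, rfl, h⟩ := h
      rw [Nat.lt_one_iff.1 h]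
      ring
    · rfl
  rw [State.doubled, this]
  simp

theorem State.write_zero_zero (s : State d) (A : ℕ) (v : ℝ) :
    s.write A (.const 0) (.const 0) v = { s with arr := fillRow s.arr A 0 1 fun _ => v } := by
  have := fillRow_succ s.arr A 0 0 fun _ => v
  rw [fillRow_zero] at this
  rw [← this]
  rfl

theorem exec_doublingLoop (O : Oracle d) (ω : ℕ → ℝ) (s : State d) (x : ℕ)
    (hr : 0 < s.arr 2 0 0) :
    ∃ t ≤ 19 * doublings (s.arr 2 0 0) + 5,
      Exec O ω (doublingLoop x) s (s.doubled x (doublings (s.arr 2 0 0))) t := by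
  set r := s.arr 2 0 0
  have hval : ∀ m, (s.doubled x m).val (.get 2 (.const 0) (.const 0)) = 2 ^ m * r := fun m => by
    simp [State.val, RExpr.eval, IExpr.eval, State.doubled, fillRow, r]
  have hone : ∀ m, (s.doubled x m).val (.const 1) = 1 := fun m => by
    simp [State.val, RExpr.eval]
  -- Each iteration costs 5 for the test, 10 for the doubling and 4 for the counter; the final test
  -- costs 5.
  have hloop : ∀ n m, m + n = doublings r → ∃ t ≤ 19 * n + 5,
      Exec O ω (doublingLoop x) (s.doubled x m) (s.doubled x (doublings r)) t := by
    intro n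
    induction n with
    | zero =>
      rintro m hm
      obtain rfl : m = doublings r := hm
      refine ⟨_, ?_, Exec.loopFalse _ _ _ _ ?_⟩
      · simp [RExpr.cost, IExpr.cost]
      · rw [hval, hone, not_lt]
        exact one_le_two_pow_doublings_mul hr
    | succ n ih =>
      intro m hm
      obtain ⟨t, ht, he⟩ := ih (m + 1) (by omega)
      have hset := Exec.set (O := O) (ω := ω) (s.doubled x m) 2 (.const 0) (.const 0)
        (.add (.get 2 (.const 0) (.const 0)) (.get 2 (.const 0) (.const 0)))
      have hidx := Exec.setIndex (O := O) (ω := ω) ((s.doubled x m).write 2 (.const 0) (.const 0)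
        ((s.doubled x m).val (.add (.get 2 (.const 0) (.const 0)) (.get 2 (.const 0) (.const 0)))))
        x (.add (.var x) (.const 1))
      have hst : ∀ v, (s.doubled x m).val
          (.add (.get 2 (.const 0) (.const 0)) (.get 2 (.const 0) (.const 0))) = v →
          v = 2 ^ (m + 1) * r → { (s.doubled x m).write 2 (.const 0) (.const 0) v with
            idx := Function.update ((s.doubled x m).write 2 (.const 0) (.const 0) v).idx x
              ((IExpr.add (.var x) (.const 1)).eval
                ((s.doubled x m).write 2 (.const 0) (.const 0) v).idx) } =
          s.doubled x (m + 1) := by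
        rintro v - rfl
        have harr : fillRow (fillRow s.arr 2 0 1 fun _ => 2 ^ m * s.arr 2 0 0) 2 0 1
            (fun _ => 2 ^ (m + 1) * r) = fillRow s.arr 2 0 1 fun _ => 2 ^ (m + 1) * r := by
          funext B i j
          simp only [fillRow]
          split_ifs <;> rfl
        rw [State.write_zero_zero]
        simp only [State.doubled, harr, IExpr.eval, Function.update_self, Function.update_idem,
          Nat.add_assoc]
        rfl
      have hsum : (s.doubled x m).val
          (.add (.get 2 (.const 0) (.const 0)) (.get 2 (.const 0) (.const 0))) =
          2 ^ (m + 1) * r := by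
        have := hval m
        simp only [State.val] at this ⊢
        rw [RExpr.eval, this]
        ring
      rw [hst _ rfl hsum] at hidx
      refine ⟨_, ?_, Exec.loopTrue _ _ _ _ _ _ _ _ ?_ (Exec.seq _ _ _ _ _ _ _ hset hidx) he⟩
      · simp only [RExpr.cost, IExpr.cost]
        omega
      · rw [hval, hone]
        exact two_pow_mul_lt_one (by omega)
  obtain ⟨t, ht, he⟩ := hloop (doublings r) 0 (by omega)
  rw [State.doubled_zero] at he
  exact ⟨t, ht, he⟩

/-- The number of bases. -/
noncomputable def numBases (δ : ℝ) : ℕ := 1 + doublings δ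

/-- The truncation level. -/
noncomputable def level (d : ℕ) (ε : ℝ) : ℝ := 16 * (doublings ε + 1) / √d

theorem exec_paramProg (O : Oracle d) (ω : ℕ → ℝ) {ε δ : ℝ} (hε : 0 < ε) (hδ : 0 < δ) :
    ∃ s t, Exec O ω paramProg (init d ε δ) s t ∧ t ≤ 19 * (doublings ε + numBases δ) + 50 ∧
      (∀ x, s.idx x ≤ d + doublings ε + numBases δ) ∧
      CollectInv O ω (level d ε) (numBases δ) 0 0 s := by
  have h1 := Exec.set (O := O) (ω := ω) (init d ε δ) 2 (.const 0) (.const 0)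
    (.get 0 (.const 0) (.const 0))
  rw [State.write_zero_zero] at h1
  set s₁ : State d := { init d ε δ with
    arr := fillRow (init d ε δ).arr 2 0 1 fun _ => (init d ε δ).val (.get 0 (.const 0) (.const 0)) }
  have hs₁ : s₁.arr 2 0 0 = ε := by
    simp [s₁, fillRow, State.val, RExpr.eval, IExpr.eval, init]
  obtain ⟨t₂, ht₂, h2⟩ := exec_doublingLoop O ω s₁ 2 (by rwa [hs₁])
  rw [hs₁] at ht₂ h2
  set s₂ := s₁.doubled 2 (doublings ε)
  -- Starting register 1 at 1 makes the second doubling loop end with 1 + `doublings δ` there, which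
  -- is the number of bases.
  have h3 := Exec.setIndex (O := O) (ω := ω) s₂ 1 (.const 1)
  set s₃ : State d := { s₂ with idx := Function.update s₂.idx 1 ((IExpr.const 1).eval s₂.idx) }
  have h4 := Exec.set (O := O) (ω := ω) s₃ 2 (.const 0) (.const 0) (.get 0 (.const 0) (.const 1))
  rw [State.write_zero_zero] at h4
  set s₄ : State d := { s₃ with
    arr := fillRow s₃.arr 2 0 1 fun _ => s₃.val (.get 0 (.const 0) (.const 1)) }
  have hs₄ : s₄.arr 2 0 0 = δ := by
    simp [s₄, s₃, s₂, s₁, fillRow, State.val, RExpr.eval, IExpr.eval, init, State.doubled]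
  obtain ⟨t₅, ht₅, h5⟩ := exec_doublingLoop O ω s₄ 1 (by rwa [hs₄])
  rw [hs₄] at ht₅ h5
  set s₅ := s₄.doubled 1 (doublings δ)
  set e : RExpr := .div (.mul (.const 16) (.ofIndex (.add (.var 2) (.const 1))))
    (.sqrt (.ofIndex (.var 0)))
  have h6 := Exec.set (O := O) (ω := ω) s₅ 3 (.const 0) (.const 0) e
  rw [State.write_zero_zero] at h6
  have hidx : s₅.idx = Function.update (Function.update (init d ε δ).idx 2 (doublings ε)) 1
      (numBases δ) := by
    simp [s₅, s₄, s₃, s₂, s₁, State.doubled, IExpr.eval, numBases, init]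
  have hi0 : s₅.idx 0 = d := by simp [hidx, init]
  have hi1 : s₅.idx 1 = numBases δ := by simp [hidx]
  have hi2 : s₅.idx 2 = doublings ε := by simp [hidx]
  have he : s₅.val e = level d ε := by
    simp [State.val, e, RExpr.eval, IExpr.eval, hi0, hi2, level]
  rw [he] at h6
  refine ⟨_, _, Exec.seq _ _ _ _ _ _ _ h1 (Exec.seq _ _ _ _ _ _ _ h2 (Exec.seq _ _ _ _ _ _ _ h3
    (Exec.seq _ _ _ _ _ _ _ h4 (Exec.seq _ _ _ _ _ _ _ h5 h6)))), ?_, fun x => ?_, ?_⟩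
  · simp only [e, RExpr.cost, IExpr.cost, numBases]
    omega
  · simp only [hidx, Function.update_apply, init]
    split_ifs <;> omega
  · exact {
      idx0 := hi0
      idx1 := hi1
      idx10 := by simp [hidx, init]
      level := by simp [fillRow]
      coins := by simp [s₅, s₄, s₃, s₂, s₁, State.doubled, init]
      basis := fun i' hi' => by omega
      answers := fun j' i' h => by omega
      hist := by simp [s₅, s₄, s₃, s₂, s₁, State.doubled, init]
      estimates := fun j' hj' => by omega }

/-- The algorithm. -/
def meanEstimationProg : Com := .seq paramProg meanProg.compile

theorem exists_exec_meanEstimationProg :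
    ∃ f, PolyBounded f ∧ ∀ {d : ℕ} (O : Oracle d) (ω : ℕ → ℝ) {ε δ : ℝ}, 1 ≤ d → 0 < ε → 0 < δ →
      ∃ s t, Exec O ω meanEstimationProg (init d ε δ) s t ∧
        t ≤ f (d + doublings ε + numBases δ) ∧
        ∃ y : Fin (numBases δ) → Fin d → ℝ,
          s.hist = (List.finRange (numBases δ)).flatMap (fun j : Fin (numBases δ) =>
            (List.finRange d).map fun i : Fin d =>
            (truncQuery (fun i : Fin d => coinBasis d ω j i) (level d ε) i, y j i)) ∧
          (∀ j i, ∃ h, y j i =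
            O h (truncQuery (fun i : Fin d => coinBasis d ω j i) (level d ε) i)) ∧
          ∃ j : Fin (numBases δ),
            IsMedianPoint (fun l : Fin (numBases δ) =>
              basisEstimate (fun i : Fin d => coinBasis d ω l i) (level d ε) (y l)) j ∧
            s.output = basisEstimate (fun i : Fin d => coinBasis d ω j i) (level d ε) (y j) := by
  obtain ⟨f, hf, h⟩ := meanProg.exists_exec meanProg_wellFormed
  refine ⟨_, (((PolyBounded.const 19).mul .id).add (.const 50)).add hf,
    fun {d} O ω {ε δ} hd hε hδ => ?_⟩
  obtain ⟨s, t, hs, ht, hidx, hinv⟩ := exec_paramProg O ω hε hδ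
  obtain ⟨t', ht', hs'⟩ := h O ω _ s (by omega) hidx
  refine ⟨_, _, Exec.seq _ _ _ _ _ _ _ hs hs', ?_,
    hinv.run_meanProg (by unfold numBases; omega)⟩
  omega

/-! ### Choice of the constants -/

theorem numBases_le {δ : ℝ} (hδ : 0 < δ) :
    (numBases δ : ℝ) ≤ 4 * max 1 (Real.log (1 / δ)) := by
  have h1 := doublings_le hδ
  have h2 : (1 : ℝ) ≤ max 1 (Real.log (1 / δ)) := le_max_left _ _
  rw [numBases]
  push_cast
  linarith

theorem half_pow_numBases_le {δ : ℝ} (hδ : 0 < δ) :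
    ((1 / 2 : ENNReal)) ^ numBases δ ≤ ENNReal.ofReal δ := by
  have h : (1 / 2 : ENNReal) = ENNReal.ofReal (1 / 2) := by
    rw [ENNReal.ofReal_div_of_pos two_pos]
    simp
  rw [h, ← ENNReal.ofReal_pow (by norm_num)]
  refine ENNReal.ofReal_le_ofReal ?_
  have h1 := one_le_two_pow_doublings_mul hδ
  rw [numBases, pow_add, one_div, inv_pow, inv_pow]
  have h2 : ((2 : ℝ) ^ doublings δ)⁻¹ ≤ δ := by
    rw [inv_le_iff_one_le_mul₀' (by positivity)]
    exact h1
  linarith [inv_nonneg.2 (by positivity : (0 : ℝ) ≤ 2 ^ doublings δ)]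

theorem level_pos (hd : 1 ≤ d) (ε : ℝ) : 0 < level d ε := by
  have : (0 : ℝ) < d := by exact_mod_cast hd
  unfold level
  positivity

theorem sqrt_mul_level (hd : 1 ≤ d) (ε : ℝ) : √d * level d ε = 16 * (doublings ε + 1) := by
  have : (0 : ℝ) < d := by exact_mod_cast hd
  unfold level
  field_simp

/-- With L = max(1, log(1/ε)), the left factor is at most 16(3L + 1) ≤ 64L, and 64/400 < 1/6. This
fixes the constant in τ. -/
theorem sqrt_mul_level_mul_le (hd : 1 ≤ d) {ε : ℝ} (hε : 0 < ε) :
    √d * level d ε * (1 / 400 * ε / max 1 (Real.log (1 / ε))) ≤ ε / 6 := by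
  have h1 := doublings_le hε
  have h2 : (1 : ℝ) ≤ max 1 (Real.log (1 / ε)) := le_max_left _ _
  rw [sqrt_mul_level hd]
  rw [mul_div_assoc', div_le_iff₀ (by linarith)]
  nlinarith

/-- With m doublings the exponent 16(m + 1) - 1/2 is at least 15 + 2m, and exp(-1) ≤ 1/2. The factor
4^(-m) is at most ε², so 2^(-15) is left to beat 4 · 36 · 16. -/
theorem four_mul_exp_div_le (hd : 1 ≤ d) {ε : ℝ} (hε : 0 < ε) :
    4 * Real.exp (1 / 2 - √d * level d ε) / (ε / 6) ^ 2 ≤ 1 / 16 := by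
  set m := doublings ε
  have h1 : 1 ≤ 2 ^ m * ε := one_le_two_pow_doublings_mul hε
  have h2 : Real.exp (1 / 2 - √d * level d ε) ≤ 1 / 2 ^ 15 * (1 / 4) ^ m := by
    rw [sqrt_mul_level hd]
    have he : Real.exp (-1) ≤ 1 / 2 := by
      rw [Real.exp_neg, one_div]
      have := Real.exp_one_gt_d9
      gcongr
      linarith
    calc Real.exp (1 / 2 - 16 * ((m : ℝ) + 1)) ≤ Real.exp (((15 + 2 * m : ℕ) : ℝ) * (-1)) := by
          refine Real.exp_le_exp.2 ?_
          push_cast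
          have : (0 : ℝ) ≤ m := Nat.cast_nonneg m
          linarith
      _ = Real.exp (-1) ^ (15 + 2 * m) := Real.exp_nat_mul _ _
      _ ≤ (1 / 2) ^ (15 + 2 * m) := by gcongr
      _ = _ := by
          rw [pow_add, pow_mul]
          norm_num
  have h3 : (1 / 4 : ℝ) ^ m ≤ ε ^ 2 := by
    have h4 : (1 : ℝ) ≤ 4 ^ m * ε ^ 2 := by
      have h5 : (4 : ℝ) ^ m * ε ^ 2 = (2 ^ m * ε) ^ 2 := by
        rw [mul_pow, ← pow_mul, mul_comm m 2, pow_mul]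
        norm_num
      rw [h5]
      exact one_le_pow₀ h1
    rw [one_div, inv_pow, inv_le_iff_one_le_mul₀' (by positivity)]
    exact h4
  rw [div_le_iff₀ (by positivity)]
  nlinarith

theorem isSTAT_truncQuery {D : Measure (E d)} {τ : ℝ} {O : Oracle d} (hO : IsSTAT D τ O)
    (h : History d) (u : Fin d → E d) {a : ℝ} (ha : 0 < a) (i : Fin d) :
    |O h (truncQuery u a i) - ∫ w, truncQuery u a i w ∂D| ≤ τ := by
  have hc := (continuous_truncate a).measurable
  refine hO h _ (by unfold truncQuery; fun_prop) fun w _ => ?_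
  rw [Set.mem_Icc, ← abs_le, truncQuery, abs_div, abs_of_pos ha, div_le_one ha]
  exact abs_truncate_le ha.le _

end RealRAM

/-! ### Assembly of the theorem -/

theorem mainTheorem5 :
    ∃ (P : RealRAM.Com) (c C : ℝ) (K : ℕ), 0 < c ∧ 0 < C ∧
      ∀ (d : ℕ) (ε δ : ℝ), 1 ≤ d → 0 < ε → 0 < δ → δ < 1 →
        ∃ (k : ℕ) (a : ℝ) (u : (ℕ → ℝ) → Fin k → Fin d → E d),
          -- `u 0, …, u (k-1)` are independent uniformly random orthonormal bases
          0 < a ∧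
          (∀ j, Measurable fun ω => u ω j) ∧
          (∀ j, IsUniformOrthonormalBasis (RealRAM.coinLaw.map fun ω => u ω j)) ∧
          iIndepFun (fun j ω => u ω j) RealRAM.coinLaw ∧
          ∀ D : Measure (E d), IsProbabilityMeasure D → D (Metric.closedBall 0 1)ᶜ = 0 →
            ∀ O : Oracle d, IsSTAT D (c * ε / max 1 (Real.log (1 / ε))) O →
              -- number of steps and of queries
              (∀ ω : ℕ → ℝ, ∃ (s : RealRAM.State d) (t : ℕ),
                RealRAM.Exec O ω P (RealRAM.init d ε δ) s t ∧
                (s.hist.length : ℝ) ≤ C * d * max 1 (Real.log (1 / δ)) ∧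
                (t : ℝ) ≤ C * (d * max 1 (Real.log (1 / ε)) * max 1 (Real.log (1 / δ))) ^ K) ∧
              -- the run truncates coordinates in the random bases and returns a median
              (∀ᵐ ω ∂(RealRAM.coinLaw), ∃ (s : RealRAM.State d) (t : ℕ),
                RealRAM.Exec O ω P (RealRAM.init d ε δ) s t ∧
                IsTruncationMedianRun (u ω) a s) ∧
              -- success probability
              RealRAM.coinLaw {ω | ∃ (s : RealRAM.State d) (t : ℕ),
                RealRAM.Exec O ω P (RealRAM.init d ε δ) s t ∧
                ε < ‖(∫ w, w ∂D) - s.output‖} ≤ ENNReal.ofReal δ := by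
  obtain ⟨f, ⟨C, K, hf⟩, hrun⟩ := RealRAM.exists_exec_meanEstimationProg
  -- The 8 comes from d + 3Lε + 4Lδ ≤ 8 d Lε Lδ, where Lε and Lδ are the two logarithmic factors;
  -- the 4 pays for the k d queries.
  refine ⟨RealRAM.meanEstimationProg, 1 / 400, C * 8 ^ K + 4, K, by norm_num, by positivity,
    fun d ε δ hd hε hδ _ => ?_⟩
  set k := RealRAM.numBases δ
  set a := RealRAM.level d ε
  have ha : 0 < a := RealRAM.level_pos hd ε
  refine ⟨k, a, fun ω j i => RealRAM.coinBasis d ω j i, ha,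
    fun j => RealRAM.measurable_coinBasis d j,
    fun j => RealRAM.isUniformOrthonormalBasis_coinBasis d j,
    RealRAM.iIndepFun_coinBasis d k, fun D hD hball O hO => ⟨fun ω => ?_, ?_, ?_⟩⟩
  · obtain ⟨s, t, hs, ht, y, hhist, -⟩ := hrun O ω hd hε hδ
    have hk := RealRAM.numBases_le hδ
    have hm := RealRAM.doublings_le hε
    set Lε := max 1 (Real.log (1 / ε))
    set Lδ := max 1 (Real.log (1 / δ))
    have h1 : 1 ≤ Lε := le_max_left _ _
    have h2 : 1 ≤ Lδ := le_max_left _ _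
    have hd' : (1 : ℝ) ≤ d := by exact_mod_cast hd
    have hC : (0 : ℝ) ≤ C * 8 ^ K := by positivity
    refine ⟨s, t, hs, ?_, ?_⟩
    · have hlen : s.hist.length = k * d := by simp [hhist, k]
      rw [hlen]
      push_cast
      calc (k : ℝ) * d ≤ 4 * Lδ * d := by gcongr
        _ ≤ (C * 8 ^ K + 4) * d * Lδ := by
            have : 0 ≤ (C : ℝ) * 8 ^ K * d * Lδ := by positivity
            linarith
    · have hN : ((d + RealRAM.doublings ε + k : ℕ) : ℝ) ≤ 8 * (d * Lε * Lδ) := by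
        push_cast
        have e1 : (d : ℝ) ≤ d * Lε * Lδ := by
          rw [mul_assoc]
          exact le_mul_of_one_le_right (by linarith) (one_le_mul_of_one_le_of_one_le h1 h2)
        have e2 : Lε ≤ d * Lε * Lδ := by
          calc Lε ≤ d * Lε := le_mul_of_one_le_left (by linarith) hd'
            _ ≤ d * Lε * Lδ := le_mul_of_one_le_right (by positivity) h2
        have e3 : Lδ ≤ d * Lε * Lδ :=
          le_mul_of_one_le_left (by linarith) (one_le_mul_of_one_le_of_one_le hd' h1)
        linarith
      calc (t : ℝ) ≤ ((C * (d + RealRAM.doublings ε + k) ^ K : ℕ) : ℝ) := by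
            exact_mod_cast ht.trans (hf _ (by omega))
        _ = C * ((d + RealRAM.doublings ε + k : ℕ) : ℝ) ^ K := by push_cast; rfl
        _ ≤ C * (8 * (d * Lε * Lδ)) ^ K := by gcongr
        _ = C * 8 ^ K * (d * Lε * Lδ) ^ K := by rw [mul_pow]; ring
        _ ≤ (C * 8 ^ K + 4) * (d * Lε * Lδ) ^ K := by
            gcongr
            linarith
  · refine Filter.Eventually.of_forall fun ω => ?_
    obtain ⟨s, t, hs, -, y, hhist, -, hmed⟩ := hrun O ω hd hε hδ
    exact ⟨s, t, hs, y, hhist, hmed⟩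
  · classical
    set B := badFrames D a (ε / 6)
    have hB : MeasurableSet B := measurableSet_badFrames D a (ε / 6)
    have hp : ∀ j : Fin k, RealRAM.coinLaw
        ((fun ω (i : Fin d) => RealRAM.coinBasis d ω j i) ⁻¹' B) ≤ 1 / 16 := fun j => by
      rw [← Measure.map_apply (RealRAM.measurable_coinBasis d j) hB]
      refine (measure_badFrames_le (RealRAM.isUniformOrthonormalBasis_coinBasis d j) hball ha.le
        (by positivity)).trans ?_
      refine (ENNReal.ofReal_le_ofReal (RealRAM.four_mul_exp_div_le hd hε)).trans (le_of_eq ?_)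
      rw [ENNReal.ofReal_div_of_pos (by norm_num)]
      simp
    -- Almost surely a failing run has at least half of its bases bad. This event does not involve
    -- the oracle.
    refine le_trans (measure_mono_ae ?_) ((measure_half_of_iIndepFun_mem_le
      (RealRAM.iIndepFun_coinBasis d k) hB hp).trans (RealRAM.half_pow_numBases_le hδ))
    have hon : ∀ᵐ ω ∂(RealRAM.coinLaw), ∀ j : Fin k,
        Orthonormal ℝ fun i : Fin d => RealRAM.coinBasis d ω j i := ae_all_iff.2 fun j =>
      ae_of_ae_map (RealRAM.measurable_coinBasis d j).aemeasurable
        (RealRAM.isUniformOrthonormalBasis_coinBasis d j).2.1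
    filter_upwards [hon] with ω hω
    rintro ⟨s, t, hs, hfail⟩
    obtain ⟨s', t', hs', -, y, -, hy, j, hj, hout⟩ := hrun O ω hd hε hδ
    -- By determinism the failing run is the run that has been analysed.
    obtain ⟨rfl, -⟩ := hs.deterministic hs'
    by_contra hmaj
    refine absurd hfail (not_lt.2 ?_)
    -- Truncation and answers contribute ε/6 each; the median multiplies the sum ε/3 by 3.
    have hgood : ∀ l : Fin k, (fun i : Fin d => RealRAM.coinBasis d ω l i) ∉ B →
        ‖(∫ w, w ∂D) - basisEstimate (fun i : Fin d => RealRAM.coinBasis d ω l i) a (y l)‖ ≤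
          ε / 3 := fun l hl => by
      refine (norm_mean_sub_basisEstimate_le hball (hω l) ha (by positivity)
        (τ := 1 / 400 * ε / max 1 (Real.log (1 / ε))) (by positivity) hl fun i => ?_).trans ?_
      · obtain ⟨h, hh⟩ := hy l i
        rw [hh]
        exact RealRAM.isSTAT_truncQuery hO h _ ha i
      · linarith [RealRAM.sqrt_mul_level_mul_le hd hε]
    change IsMedianPoint (fun l : Fin k =>
      basisEstimate (fun i : Fin d => RealRAM.coinBasis d ω l i) a (y l)) j at hj
    rw [hout]
    refine (hj.norm_sub_le (z := ∫ w, w ∂D) (ρ := ε / 3) ?_).trans (by linarith)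
    have hcard := Finset.card_filter_add_card_filter_not (s := (Finset.univ : Finset (Fin k)))
      (fun l => (fun i : Fin d => RealRAM.coinBasis d ω l i) ∈ B)
    have hmaj' : ¬ k ≤ 2 * (Finset.univ.filter fun l : Fin k =>
      (fun i : Fin d => RealRAM.coinBasis d ω l i) ∈ B).card := hmaj
    have hsub := Finset.card_le_card (Finset.monotone_filter_right Finset.univ
      (fun l _ hl => hgood l hl))
    rw [Finset.card_univ, Fintype.card_fin] at hcard
    omega
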